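/- Let $q_0,q_1,q_2\in\mathbb R^2$ be the vertices of an equilateral triangle, $F_i(x)=\frac12(x-q_i)+q_i$, let $SG$ be the Sierpinski gasket, i.e. the attractor of $\{F_0,F_1,F_2\}$, and let $\mu$ be the probability measure on $SG$ giving weight $3^{-m}$ to each cell $F_{w_1}\circ\cdots\circ F_{w_m}(SG)$. Write $\langle u,v\rangle=\int_{SG}uv\,d\mu$ and $\|u\|^2=\langle u,u\rangle$. Put $V_0=\{q_0,q_1,q_2\}$, $V_{m+1}=\bigcup_iF_i(V_m)$, and for $x\in V_m\setminus V_0$ let $\Delta_mu(x)=\sum_{y\sim_mx}(u(y)-u(x))$, where $y\sim_mx$ means that $y\ne x$ is a point of $V_m$ lying in a common cell of level $m$ with $x$. For continuous $u,f$ on $SG$, $\Delta u=f$ means that $\frac32 5^m\Delta_mu\to f$ uniformly on $V_m\setminus V_0$ as $m\to\infty$. With indices mod 3, let $$\partial_nu(q_i)=\lim_{m\to\infty}\left(\tfrac53\right)^m\left(2u(q_i)-u(F_i^mq_{i+1})-u(F_i^mq_{i-1})\right),\qquad \partial_Tu(q_i)=\lim_{m\to\infty}5^m\left(u(F_i^mq_{i+1})-u(F_i^mq_{i-1})\right).$$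 For $j\ge0$ let $P_j=P_{j3}$ be the antisymmetric monomial at $q_0$: the function with $\Delta^{j+1}P_j=0$ and, for $0\le m\le j$, $\Delta^mP_j(q_0)=0$, $\partial_n\Delta^mP_j(q_0)=0$, $\partial_T\Delta^mP_j(q_0)=\delta_{mj}$. Put $\gamma_j=P_j(q_1)$. Let $p_0,p_1,\dots$ be obtained from $P_0,P_1,\dots$ by the Gram–Schmidt process without normalization, $p_j=P_j-\sum_{l<j}\|p_l\|^{-2}\langle P_j,p_l\rangle\,p_l$. Let $G$ be Green's function of the Dirichlet problem, $$G(x,y)=\lim_{M\to\infty}\sum_{m=0}^M\ \sum_{z,z'\in V_{m+1}\setminus V_m}g(z,z')\,\psi^{(m+1)}_z(x)\,\psi^{(m+1)}_{z'}(y),$$ where $g(z,z)=\frac9{50}(\frac35)^m$, $g(z,z')=\frac3{50}(\frac35)^m$ if $z\neq z'$ lie in a common cell of level $m+1$, $g(z,z')=0$ otherwise, and $\psi_z^{(m)}$ is the continuous function that is harmonic on each cell of level $m$ and equals $\delta_{zx}$ at each $x\in V_m$. For $k\ge0$ put $$f_{k+1}(x)=-\int_{SG}G(x,y)p_k(y)\,d\mu(y),\qquad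 b_k=\frac{\langle f_{k+1},p_k\rangle}{\|p_k\|^2},\qquad c_k=\frac{\|p_k\|^2}{\|p_{k-1}\|^2}\ \ (k\ge1).$$ **Theorem.** For each $k\ge0$ there is exactly one vector $\Omega_k=(\omega_{k,0},\dots,\omega_{k,k})^T\in\mathbb R^{k+1}$ with $p_k=\sum_{l=0}^k\omega_{k,l}P_l$; it satisfies $\omega_{k,k}=1$; and for every $k\ge0$ $$\Omega_{k+1}=\begin{pmatrix}\zeta_k\\ \Omega_k\end{pmatrix}-b_k\begin{pmatrix}\Omega_k\\0\end{pmatrix}-c_k\begin{pmatrix}\Omega_{k-1}\\0\\0\end{pmatrix},\qquad \zeta_k=-\frac1{\gamma_0}\sum_{l=0}^k\omega_{k,l}\,\gamma_{l+1},$$ where for $k=0$ the last term is absent (as $p_{-1}=0$). -/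

import Mathlib

open Filter Topology MeasureTheory

noncomputable section

namespace SGOP

/-- The plane. -/
abbrev Plane : Type := EuclideanSpace ℝ (Fin 2)

/-! ### The gasket as the attractor of three contractions

Everything depends on a choice of three points `q 0, q 1, q 2` of the plane (later: the vertices of
an equilateral triangle). -/

/-- The contraction `x ↦ (x - q i) / 2 + q i` of the plane. -/
def contraction (q : Fin 3 → Plane) (i : Fin 3) (x : Plane) : Plane :=
  (1 / 2 : ℝ) • (x - q i) + q i

/-- The limit point `lim_n F_{w 0} ∘ ⋯ ∘ F_{w n} (x)` (any `x`) with address `w`; since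
`F_i x = x / 2 + q i / 2`, it is the sum of the series `∑ q (w n) / 2 ^ (n + 1)`. -/
def address (q : Fin 3 → Plane) (w : ℕ → Fin 3) : Plane :=
  ∑' n, ((1 / 2 : ℝ) ^ (n + 1)) • q (w n)

/-- The Sierpinski gasket: the attractor of the three contractions, i.e. the set of all points that
have an address (see `isCompact_gasket` and `gasket_eq_iUnion`). -/
def gasket (q : Fin 3 → Plane) : Set Plane := Set.range (address q)

/-- The gasket as a space of its own. -/
abbrev SG (q : Fin 3 → Plane) : Type := gasket q

theorem norm_term_le (q : Fin 3 → Plane) (n : ℕ) (w : ℕ → Fin 3) :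
    ‖((1 / 2 : ℝ) ^ (n + 1)) • q (w n)‖ ≤ (1 / 2 : ℝ) ^ n * ((1 / 2) * ∑ i, ‖q i‖) := by
  have h : ‖q (w n)‖ ≤ ∑ i, ‖q i‖ :=
    Finset.single_le_sum (f := fun i => ‖q i‖) (fun i _ => norm_nonneg _) (Finset.mem_univ _)
  rw [norm_smul, Real.norm_of_nonneg (by positivity), pow_succ, mul_assoc]
  gcongr

theorem summable_bound (q : Fin 3 → Plane) :
    Summable fun n : ℕ => (1 / 2 : ℝ) ^ n * ((1 / 2) * ∑ i, ‖q i‖) :=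
  summable_geometric_two.mul_right _

theorem summable_term (q : Fin 3 → Plane) (w : ℕ → Fin 3) :
    Summable fun n : ℕ => ((1 / 2 : ℝ) ^ (n + 1)) • q (w n) :=
  Summable.of_norm_bounded (summable_bound q) fun n => norm_term_le q n w

theorem continuous_address (q : Fin 3 → Plane) : Continuous (address q) := by
  refine continuous_tsum (fun n => ?_) (summable_bound q) (fun n w => norm_term_le q n w)
  have h : Continuous fun w : ℕ → Fin 3 => q (w n) :=
    (continuous_of_discreteTopology (f := q)).comp (continuous_apply n)
  exact h.const_smul ((1 / 2 : ℝ) ^ (n + 1))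

theorem contraction_address (q : Fin 3 → Plane) (i : Fin 3) (w : ℕ → Fin 3) :
    contraction q i (address q w) = address q (fun n => Nat.casesOn n i w) := by
  unfold contraction address
  rw [(summable_term q (fun n => Nat.casesOn n i w)).tsum_eq_zero_add]
  have h : ∀ n : ℕ, ((1 / 2 : ℝ) ^ (n + 1 + 1)) • q (w n)
      = (1 / 2 : ℝ) • (((1 / 2 : ℝ) ^ (n + 1)) • q (w n)) := by
    intro n
    rw [smul_smul, pow_succ (1 / 2 : ℝ) (n + 1), mul_comm]
  simp only [h]
  rw [(summable_term q w).tsum_const_smul (1 / 2 : ℝ)]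
  module

theorem address_const (q : Fin 3 → Plane) (i : Fin 3) : address q (fun _ => i) = q i := by
  unfold address
  have h : HasSum (fun n : ℕ => (1 / 2 : ℝ) ^ (n + 1)) 1 := by
    have := (hasSum_geometric_two).mul_right (1 / 2 : ℝ)
    simpa [pow_succ] using this
  simpa using (h.smul_const (q i)).tsum_eq

theorem contraction_mem (q : Fin 3 → Plane) (i : Fin 3) {x : Plane} (hx : x ∈ gasket q) :
    contraction q i x ∈ gasket q := by
  obtain ⟨w, rfl⟩ := hx
  exact ⟨_, (contraction_address q i w).symm⟩

theorem continuous_contraction (q : Fin 3 → Plane) (i : Fin 3) : Continuous (contraction q i) := by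
  unfold contraction
  fun_prop

theorem isCompact_gasket (q : Fin 3 → Plane) : IsCompact (gasket q) :=
  isCompact_range (continuous_address q)

/-- The self-similar identity. -/
theorem gasket_eq_iUnion (q : Fin 3 → Plane) :
    gasket q = ⋃ i, contraction q i '' gasket q := by
  apply Set.Subset.antisymm
  · rintro _ ⟨w, rfl⟩
    refine Set.mem_iUnion.2 ⟨w 0, address q (fun n => w (n + 1)), ⟨_, rfl⟩, ?_⟩
    rw [contraction_address]
    congr 1
    funext n
    cases n <;> rfl
  · refine Set.iUnion_subset fun i => ?_
    rintro _ ⟨x, hx, rfl⟩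
    exact contraction_mem q i hx

/-- The boundary points `q 0, q 1, q 2`, as points of the gasket. -/
def bdry (q : Fin 3 → Plane) (i : Fin 3) : SG q := ⟨q i, fun _ => i, address_const q i⟩

/-- The contractions `F_i`, as maps of the gasket into itself. -/
def F (q : Fin 3 → Plane) (i : Fin 3) : C(SG q, SG q) where
  toFun x := ⟨contraction q i x, contraction_mem q i x.2⟩
  continuous_toFun :=
    ((continuous_contraction q i).comp continuous_subtype_val).subtype_mk _

/-- `F_w = F_{w_1} ∘ ⋯ ∘ F_{w_m}` for a word `w = (w_1, …, w_m)`. -/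
def wordMap (q : Fin 3 → Plane) : List (Fin 3) → C(SG q, SG q)
  | [] => ContinuousMap.id _
  | i :: w => (F q i).comp (wordMap q w)

/-- The natural probability measure on the gasket, giving weight `3 ^ (-m)` to each cell of
level `m`: the law of the point whose address is a sequence of independent, uniformly distributed
symbols. -/
def mu (q : Fin 3 → Plane) : Measure (SG q) :=
  (Measure.infinitePi fun _ : ℕ => (PMF.uniformOfFintype (Fin 3)).toMeasure).map
    (Set.rangeFactorization (address q))

/-- The inner product of `L²(SG, μ)`. -/
def ip (q : Fin 3 → Plane) (u v : SG q → ℝ) : ℝ := ∫ x, u x * v x ∂(mu q)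

/-! ### Graph approximations, Laplacian, boundary derivatives -/

open scoped Classical in
/-- The vertex sets: `V_0 = {q 0, q 1, q 2}` and `V_{m+1} = ⋃ i, F_i V_m`. -/
def V (q : Fin 3 → Plane) : ℕ → Finset (SG q)
  | 0 => Finset.univ.image (bdry q)
  | m + 1 => Finset.univ.biUnion fun i => (V q m).image (F q i)

/-- `x` and `y` belong to a common cell `F_w(SG)` of level `|w| = m`. -/
def SameCell (q : Fin 3 → Plane) (m : ℕ) (x y : SG q) : Prop :=
  ∃ w : List (Fin 3), w.length = m ∧ x ∈ Set.range (wordMap q w) ∧ y ∈ Set.range (wordMap q w)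

open scoped Classical in
/-- The graph Laplacian `∑_{y ∼_m x} (u y - u x)`, the neighbours of `x` being the other vertices
`y ∈ V_m` that share a cell of level `m` with `x`. -/
def graphLaplacian (q : Fin 3 → Plane) (m : ℕ) (u : SG q → ℝ) (x : SG q) : ℝ :=
  ∑ y ∈ (V q m).filter (fun y => y ≠ x ∧ SameCell q m x y), (u y - u x)

/-- `u` is in the domain of the Laplacian and `Δ u = f`: the renormalized graph Laplacians
`(3/2) 5^m Δ_m u` converge to the continuous function `f`, uniformly on `V_m \ V_0`. -/
def HasLaplacian (q : Fin 3 → Plane) (u f : C(SG q, ℝ)) : Prop :=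
  ∀ ε > 0, ∃ N : ℕ, ∀ m ≥ N, ∀ x ∈ V q m, x ∉ V q 0 →
    |3 / 2 * 5 ^ m * graphLaplacian q m u x - f x| < ε

/-- The normal derivative of `u` at the boundary point `q i` exists and equals `d`
(indices are taken modulo 3). -/
def HasNormalDeriv (q : Fin 3 → Plane) (u : SG q → ℝ) (i : Fin 3) (d : ℝ) : Prop :=
  Tendsto (fun m : ℕ => (5 / 3 : ℝ) ^ m *
    (2 * u (bdry q i) - u ((F q i)^[m] (bdry q (i + 1))) - u ((F q i)^[m] (bdry q (i - 1)))))
    atTop (𝓝 d)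

/-- The tangential derivative of `u` at the boundary point `q i` exists and equals `d`. -/
def HasTangentialDeriv (q : Fin 3 → Plane) (u : SG q → ℝ) (i : Fin 3) (d : ℝ) : Prop :=
  Tendsto (fun m : ℕ => (5 : ℝ) ^ m *
    (u ((F q i)^[m] (bdry q (i + 1))) - u ((F q i)^[m] (bdry q (i - 1)))))
    atTop (𝓝 d)

/-! ### Monomials -/

/-- The defining property of the monomial `P_{ji}^{(n)}`, `i = 1, 2, 3`: it solves
`Δ^{j+1} u = 0`, and for `0 ≤ m ≤ j` the value, the normal derivative and the tangential derivative
of `Δ^m u` at `q n` are `δ_{mj} δ_{i1}`, `δ_{mj} δ_{i2}` and `δ_{mj} δ_{i3}`.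
Here `D m` is `Δ^m u`. -/
def IsMonomial (q : Fin 3 → Plane) (n : Fin 3) (j i : ℕ) (u : C(SG q, ℝ)) : Prop :=
  ∃ D : ℕ → C(SG q, ℝ), D 0 = u ∧ (∀ m ≤ j, HasLaplacian q (D m) (D (m + 1))) ∧ D (j + 1) = 0 ∧
    ∀ m ≤ j,
      D m (bdry q n) = (if m = j ∧ i = 1 then 1 else 0) ∧
      HasNormalDeriv q (D m) n (if m = j ∧ i = 2 then 1 else 0) ∧
      HasTangentialDeriv q (D m) n (if m = j ∧ i = 3 then 1 else 0)

/-- The monomial `P_{ji}^{(n)}`: the function with the defining property above. -/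
def monomial (q : Fin 3 → Plane) (n : Fin 3) (j i : ℕ) : C(SG q, ℝ) :=
  Classical.epsilon (IsMonomial q n j i)

/-- The monomials `P_{j3} = P_{j3}^{(0)}`, antisymmetric with respect to `q 0`. -/
def P (q : Fin 3 → Plane) (j : ℕ) : C(SG q, ℝ) := monomial q 0 j 3

/-- `γ_j = P_{j3}(q 1)`. -/
def gam (q : Fin 3 → Plane) (j : ℕ) : ℝ := P q j (bdry q 1)

/-! ### Green's function -/

open scoped Classical in
/-- The tent function `ψ_z^{(m)}` of a vertex `z ∈ V_m`: the continuous function that is harmonic on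
each cell of level `m` and takes the value `δ_{zx}` at each `x ∈ V_m`. -/
def tent (q : Fin 3 → Plane) (m : ℕ) (z : SG q) : C(SG q, ℝ) :=
  Classical.epsilon fun u : C(SG q, ℝ) =>
    (∀ w : List (Fin 3), w.length = m → HasLaplacian q (u.comp (wordMap q w)) 0) ∧
    ∀ x ∈ V q m, u x = if x = z then 1 else 0

open scoped Classical in
/-- The coefficients `g(z, z')` for `z, z' ∈ V_{m+1} \ V_m`. -/
def greenCoeff (q : Fin 3 → Plane) (m : ℕ) (z z' : SG q) : ℝ :=
  if z = z' then 9 / 50 * (3 / 5) ^ m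
  else if SameCell q (m + 1) z z' then 3 / 50 * (3 / 5) ^ m
  else 0

open scoped Classical in
/-- `G_M(x, y)`. -/
def greenPartial (q : Fin 3 → Plane) (M : ℕ) (x y : SG q) : ℝ :=
  ∑ m ∈ Finset.range (M + 1), ∑ z ∈ V q (m + 1) \ V q m, ∑ z' ∈ V q (m + 1) \ V q m,
    greenCoeff q m z z' * tent q (m + 1) z x * tent q (m + 1) z' y

/-- Green's function `G(x, y) = lim_M G_M(x, y)`. -/
def green (q : Fin 3 → Plane) (x y : SG q) : ℝ :=
  limUnder atTop fun M : ℕ => greenPartial q M x y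

/-! ### Orthogonal polynomials and the coefficients of their three-term recursion -/

/-- The orthogonal polynomials `p_j` obtained from `P_{03}, P_{13}, …` by the Gram-Schmidt process
without normalization. -/
def p (q : Fin 3 → Plane) (j : ℕ) : C(SG q, ℝ) :=
  P q j - ∑ l : Fin j, (ip q (P q j) (p q l) / ip q (p q l) (p q l)) • p q l
termination_by j
decreasing_by all_goals exact l.2

/-- `f_{k+1}(x) = - ∫ G(x, y) p_k(y) dμ(y)`; the argument of `fNext` is `k`. -/
def fNext (q : Fin 3 → Plane) (k : ℕ) (x : SG q) : ℝ :=
  - ∫ y, green q x y * p q k y ∂(mu q)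

/-- `b_k = ⟨f_{k+1}, p_k⟩ / ‖p_k‖²`. -/
def b (q : Fin 3 → Plane) (k : ℕ) : ℝ := ip q (fNext q k) (p q k) / ip q (p q k) (p q k)

/-- `c_k = ‖p_k‖² / ‖p_{k-1}‖²` for `k ≥ 1`. As `p_{-1} = 0`, the number `c_0` plays no role; it is
set to `0`. -/
def c (q : Fin 3 → Plane) : ℕ → ℝ
  | 0 => 0
  | k + 1 => ip q (p q (k + 1)) (p q (k + 1)) / ip q (p q k) (p q k)

/-! ### Operations on coefficient vectors -/

/-- The column `(a; v)`. -/
def push {n : ℕ} (a : ℝ) (v : Fin n → ℝ) : Fin (n + 1) → ℝ := Fin.cons a v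

/-- The column `(v; 0)`. -/
def padZero {n : ℕ} (v : Fin n → ℝ) : Fin (n + 1) → ℝ := Fin.snoc v 0

/-- The vector `Ω_{k-1}` of length `k`; for `k = 0` it is the empty vector, in accordance with
`p_{-1} = 0`. -/
def prev (Om : (k : ℕ) → Fin (k + 1) → ℝ) : (k : ℕ) → Fin k → ℝ
  | 0 => Fin.elim0
  | k + 1 => Om k

/-- `ζ_k = -(1/γ_0) ∑_{l ≤ k} ω_{k,l} γ_{l+1}`, as a function of the vector `Ω_k = (ω_{k,l})_l`. -/
def zeta (q : Fin 3 → Plane) {k : ℕ} (v : Fin (k + 1) → ℝ) : ℝ :=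
  -(1 / gam q 0) * ∑ l, v l * gam q (l + 1)

end SGOP

end

namespace SGOP

/-! The argument is the one for classical orthogonal polynomials, with the operator `f ↦ -∫ G(·, y)
f(y) dμ(y)` in the role of multiplication by the variable. This operator is symmetric, its values
vanish on the boundary, and it is a right inverse of the Laplacian. As `Δ P_{l+1} = P_l`, the
functions `f_{k+1}` and `∑ ω_{k,l} P_{l+1}` differ by a harmonic function. On the boundary `f_{k+1}`
vanishes and the monomials are antisymmetric, so this difference is a multiple of `P_0`; its value
at `q 1` shows that the factor is `ζ_k` (`fNextC_eq`). Hence `f_{k+1}` has leading term `P_{k+1}`,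
and by symmetry `⟨f_{k+1}, p_l⟩ = ⟨p_k, f_{l+1}⟩` vanishes for `l + 1 < k`. This gives `p_{k+1} =
f_{k+1} - b_k p_k - c_k p_{k-1}` (`three_term_recursion`), and linear independence of the monomials
turns it into the identity of coefficient vectors.

Three analytic facts are needed. A function with Laplacian zero obeys the harmonic extension rule
(`HasLaplacian.isHarm`), because coarsening the graph by one level enlarges the graph Laplacian at
most by the factor 5. Green's function is self-similar (`green_F`), so the graph Laplacian of a
Green potential is known exactly at every vertex (`exists_graphLaplacian_greenOp`), and its limit
follows from continuity (`hasLaplacian_greenOp`). The monomials, which are defined by choice, are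
unique because a harmonic function is determined by its data at `q 0`; they exist, and are
independent, because they can be built as eigenfunctions of composition with `F_0` for the
eigenvalues `5^{-(j+1)}` (`exists_hasLaplacian_scaling`). -/

/-- The three points are the vertices of a non-degenerate equilateral triangle. -/
def Equilateral (q : Fin 3 → Plane) : Prop :=
  ∃ s : ℝ, 0 < s ∧ ∀ i j, i ≠ j → dist (q i) (q j) = s

/-! ### Barycentric coordinates -/

/-- The `i`-th barycentric coordinate with respect to an equilateral triangle. -/
noncomputable def bary (q : Fin 3 → Plane) (i : Fin 3) (x : Plane) : ℝ :=
  1 - 2 / (3 * dist (q 0) (q 1) ^ 2) *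
    inner ℝ (x - q i) ((q (i + 1) - q i) + (q (i + 2) - q i))

theorem Equilateral.inner_edges {q : Fin 3 → Plane} (hq : Equilateral q) {i j k : Fin 3}
    (hj : j ≠ i) (hk : k ≠ i) :
    inner ℝ (q j - q i) (q k - q i)
      = if j = k then dist (q 0) (q 1) ^ 2 else dist (q 0) (q 1) ^ 2 / 2 := by
  obtain ⟨s, -, h⟩ := hq
  rw [real_inner_eq_norm_mul_self_add_norm_mul_self_sub_norm_sub_mul_self_div_two,
    sub_sub_sub_cancel_right, ← dist_eq_norm, ← dist_eq_norm, ← dist_eq_norm, h _ _ hj, h _ _ hk,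
    h 0 1 (by decide)]
  split_ifs with hjk
  · subst hjk; simp; ring
  · rw [h _ _ hjk]; ring

/-- With side length `s`, each edge at `q i` has inner product `s² + s²/2` with the sum of the two
edges there; this is the origin of the factor `2 / (3 s²)` in `bary`. -/
theorem Equilateral.bary_vertex {q : Fin 3 → Plane} (hq : Equilateral q) (i j : Fin 3) :
    bary q i (q j) = if i = j then 1 else 0 := by
  have hpos : dist (q 0) (q 1) ≠ 0 := by
    obtain ⟨s, hs, h⟩ := hq
    rw [h 0 1 (by decide)]; exact hs.ne'
  by_cases hij : j = i
  · subst hij; simp [bary]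
  · rw [bary, inner_add_right, hq.inner_edges hij (by fin_cases i <;> decide),
      hq.inner_edges hij (by fin_cases i <;> decide), if_neg (Ne.symm hij)]
    have : (if j = i + 1 then dist (q 0) (q 1) ^ 2 else dist (q 0) (q 1) ^ 2 / 2)
        + (if j = i + 2 then dist (q 0) (q 1) ^ 2 else dist (q 0) (q 1) ^ 2 / 2)
        = 3 / 2 * dist (q 0) (q 1) ^ 2 := by
      fin_cases i <;> fin_cases j <;> simp at hij ⊢ <;> ring
    rw [this]
    field_simp
    ring

theorem continuous_bary (q : Fin 3 → Plane) (i : Fin 3) : Continuous (bary q i) := by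
  unfold bary
  fun_prop

theorem bary_contraction {q : Fin 3 → Plane} (hq : Equilateral q) (i k : Fin 3) (x : Plane) :
    bary q i (contraction q k x) = (bary q i x + if i = k then 1 else 0) / 2 := by
  rw [← hq.bary_vertex i k]
  have h : contraction q k x - q i = (1 / 2 : ℝ) • (x - q i) + (1 / 2 : ℝ) • (q k - q i) := by
    unfold contraction; module
  simp only [bary, h, inner_add_left, real_inner_smul_left]
  ring

theorem hasSum_address (q : Fin 3 → Plane) (w : ℕ → Fin 3) :
    HasSum (fun n : ℕ => ((1 / 2 : ℝ) ^ (n + 1)) • q (w n)) (address q w) :=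
  (summable_term q w).hasSum

theorem hasSum_half_pow : HasSum (fun n : ℕ => (1 / 2 : ℝ) ^ (n + 1)) 1 := by
  have := (hasSum_geometric_two).mul_right (1 / 2 : ℝ)
  simpa [pow_succ] using this

/-- An affine function may be applied term by term to the series of an address, whose weights sum to
1. Positivity, the partition of unity and the reflection are all read off from this expansion. -/
theorem hasSum_bary_address {q : Fin 3 → Plane} (hq : Equilateral q) (i : Fin 3) (w : ℕ → Fin 3) :
    HasSum (fun n : ℕ => (1 / 2 : ℝ) ^ (n + 1) * if i = w n then 1 else 0)
      (bary q i (address q w)) := by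
  set e := (q (i + 1) - q i) + (q (i + 2) - q i) with he
  have h1 : HasSum (fun n : ℕ => inner ℝ e (((1 / 2 : ℝ) ^ (n + 1)) • q (w n)))
      (inner ℝ e (address q w)) := (innerSL ℝ e).hasSum (hasSum_address q w)
  have h2 := (hasSum_half_pow.mul_right (inner ℝ e (q i)))
  have h3 := hasSum_half_pow.sub ((h1.sub h2).mul_left (2 / (3 * dist (q 0) (q 1) ^ 2)))
  have e1 : (fun n : ℕ => (1 / 2 : ℝ) ^ (n + 1) * if i = w n then 1 else 0) = fun n =>
      (1 / 2 : ℝ) ^ (n + 1) - 2 / (3 * dist (q 0) (q 1) ^ 2) *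
        (inner ℝ e ((1 / 2 : ℝ) ^ (n + 1) • q (w n)) - (1 / 2 : ℝ) ^ (n + 1) * inner ℝ e (q i)) := by
    funext n
    rw [← hq.bary_vertex i (w n), bary, ← he, real_inner_smul_right, inner_sub_left,
      real_inner_comm, real_inner_comm e (q i)]
    ring
  have e2 : bary q i (address q w) = 1 - 2 / (3 * dist (q 0) (q 1) ^ 2) *
      (inner ℝ e (address q w) - 1 * inner ℝ e (q i)) := by
    rw [bary, ← he, inner_sub_left, real_inner_comm, real_inner_comm e (q i)]
    ring
  rw [e1, e2]
  exact h3

/-- The barycentric coordinates as functions on the gasket. -/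
noncomputable def coord (q : Fin 3 → Plane) (i : Fin 3) (x : SG q) : ℝ := bary q i x

/-! ### The gasket in barycentric coordinates. -/

section Coord

variable {q : Fin 3 → Plane}

theorem continuous_coord (i : Fin 3) : Continuous (coord q i) :=
  (continuous_bary q i).comp continuous_subtype_val

theorem coord_bdry (hq : Equilateral q) (i j : Fin 3) :
    coord q i (bdry q j) = if i = j then 1 else 0 := hq.bary_vertex i j

theorem coord_F (hq : Equilateral q) (i k : Fin 3) (x : SG q) :
    coord q i (F q k x) = (coord q i x + if i = k then 1 else 0) / 2 := bary_contraction hq i k x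

theorem coord_nonneg (hq : Equilateral q) (i : Fin 3) (x : SG q) : 0 ≤ coord q i x := by
  obtain ⟨_, w, rfl⟩ := x
  exact (hasSum_bary_address hq i w).nonneg fun n => by positivity

theorem sum_coord (hq : Equilateral q) (x : SG q) : ∑ i, coord q i x = 1 := by
  obtain ⟨_, w, rfl⟩ := x
  refine (hasSum_sum fun i _ => hasSum_bary_address hq i w).unique ?_
  simpa using hasSum_half_pow

theorem sum_coord_smul (hq : Equilateral q) (x : SG q) : ∑ i, coord q i x • q i = (x : Plane) := by
  obtain ⟨_, w, rfl⟩ := x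
  refine (hasSum_sum fun i _ => (hasSum_bary_address hq i w).smul_const (q i)).unique ?_
  simpa using hasSum_address q w

theorem ext_coord (hq : Equilateral q) {x y : SG q} (h : ∀ i, coord q i x = coord q i y) :
    x = y := by
  apply Subtype.ext
  rw [← sum_coord_smul hq x, ← sum_coord_smul hq y]
  simp [h]

/-! ### Cells -/

theorem F_bdry_self (i : Fin 3) : F q i (bdry q i) = bdry q i :=
  Subtype.ext (by simp [F, bdry, contraction])

theorem F_bdry_comm (i j : Fin 3) : F q i (bdry q j) = F q j (bdry q i) :=
  Subtype.ext (by simp only [F, bdry, contraction, ContinuousMap.coe_mk]; module)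

theorem bdry_injective (hq : Equilateral q) : Function.Injective (bdry q) := by
  intro i j h
  have := coord_bdry hq i i
  rw [h, coord_bdry hq] at this
  by_contra hij
  simp [hij] at this

theorem F_injective (hq : Equilateral q) (i : Fin 3) : Function.Injective (F q i) := by
  intro x y h
  refine ext_coord hq fun k => ?_
  have := congrArg (coord q k) h
  rw [coord_F hq, coord_F hq] at this
  linarith

/-- The `i`-th coordinate is at least `1/2` on the cell `F_i`, and on `F_j` it is half the
coordinate of `y`. So that coordinate of `y` is 1 and the others vanish: distinct cells of level one
meet only at junction points. -/
theorem eq_bdry_of_F_eq (hq : Equilateral q) {i j : Fin 3} (hij : i ≠ j) {x y : SG q}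
    (h : F q i x = F q j y) : y = bdry q i := by
  have h1 := congrArg (coord q i) h
  rw [coord_F hq, coord_F hq, if_pos rfl, if_neg hij] at h1
  have hx := coord_nonneg hq i x
  have hs := sum_coord hq y
  refine ext_coord hq fun k => ?_
  rw [coord_bdry hq]
  have hy := fun k => coord_nonneg hq k y
  rw [Fin.sum_univ_three] at hs
  have h0 := hy 0
  have h1' := hy 1
  have h2 := hy 2
  have h3 : 1 ≤ coord q i y := by linarith
  clear hx h1
  fin_cases i <;> fin_cases k <;> simp at h3 ⊢ <;> linarith

theorem F_eq_bdry (hq : Equilateral q) {i j : Fin 3} {x : SG q} (h : F q i x = bdry q j) :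
    i = j ∧ x = bdry q j := by
  by_cases hij : i = j
  · subst hij
    exact ⟨rfl, F_injective hq i (h.trans (F_bdry_self i).symm)⟩
  · rw [← F_bdry_self j] at h
    exact absurd (bdry_injective hq (eq_bdry_of_F_eq hq hij h)).symm hij

theorem F_surjective (x : SG q) : ∃ i y, F q i y = x := by
  have hx : (x : Plane) ∈ ⋃ i, contraction q i '' gasket q := (gasket_eq_iUnion q).subset x.2
  obtain ⟨i, y, hy, h⟩ := Set.mem_iUnion.1 hx
  exact ⟨i, ⟨y, hy⟩, Subtype.ext h⟩

instance : CompactSpace (SG q) := isCompact_iff_compactSpace.1 (isCompact_gasket q)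

instance : Nonempty (SG q) := ⟨bdry q 0⟩

@[simp] theorem wordMap_nil (x : SG q) : wordMap q [] x = x := rfl

@[simp] theorem wordMap_cons (i : Fin 3) (w : List (Fin 3)) (x : SG q) :
    wordMap q (i :: w) x = F q i (wordMap q w x) := rfl

theorem exists_wordMap_eq (m : ℕ) (x : SG q) :
    ∃ w : List (Fin 3), w.length = m ∧ ∃ y, wordMap q w y = x := by
  induction m generalizing x with
  | zero => exact ⟨[], rfl, x, rfl⟩
  | succ m ih =>
    obtain ⟨i, y, rfl⟩ := F_surjective x
    obtain ⟨w, hw, z, rfl⟩ := ih y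
    exact ⟨i :: w, by simp [hw], z, rfl⟩

theorem dist_wordMap (w : List (Fin 3)) (x y : SG q) :
    dist (wordMap q w x) (wordMap q w y) = (1 / 2 : ℝ) ^ w.length * dist x y := by
  induction w with
  | nil => simp
  | cons i w ih =>
    have h : ∀ a b : SG q, dist (F q i a) (F q i b) = 1 / 2 * dist a b := by
      intro a b
      rw [Subtype.dist_eq, Subtype.dist_eq, dist_eq_norm, dist_eq_norm]
      have : ((F q i a : SG q) : Plane) - (F q i b : SG q) = (1 / 2 : ℝ) • ((a : Plane) - b) := by
        simp only [F, contraction, ContinuousMap.coe_mk]; module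
      rw [this, norm_smul]
      norm_num
    rw [wordMap_cons, wordMap_cons, h, ih, List.length_cons, pow_succ]
    ring

/-- A continuous function oscillates little on small cells. -/
theorem exists_cell_osc_lt (f : C(SG q, ℝ)) {ε : ℝ} (hε : 0 < ε) :
    ∃ N : ℕ, ∀ w : List (Fin 3), N ≤ w.length → ∀ x y,
      |f (wordMap q w x) - f (wordMap q w y)| < ε := by
  have huc := CompactSpace.uniformContinuous_of_continuous f.continuous
  obtain ⟨δ, hδ, h⟩ := Metric.uniformContinuous_iff.1 huc ε hε
  have hB : Bornology.IsBounded (Set.univ : Set (SG q)) := isCompact_univ.isBounded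
  obtain ⟨C, hC⟩ := Metric.isBounded_iff.1 hB
  have hlim : Tendsto (fun n : ℕ => (1 / 2 : ℝ) ^ n * (|C| + 1)) atTop (𝓝 0) := by
    simpa using (tendsto_pow_atTop_nhds_zero_of_lt_one (r := (1 / 2 : ℝ)) (by norm_num)
      (by norm_num)).mul_const (|C| + 1)
  obtain ⟨N, hN⟩ := (hlim.eventually (gt_mem_nhds hδ)).exists_forall_of_atTop
  refine ⟨N, fun w hw x y => ?_⟩
  have hd : dist (wordMap q w x) (wordMap q w y) < δ := by
    rw [dist_wordMap]
    refine lt_of_le_of_lt ?_ (hN _ hw)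
    gcongr
    exact (hC (Set.mem_univ x) (Set.mem_univ y)).trans (by linarith [le_abs_self C])
  have := h hd
  rwa [Real.dist_eq] at this

/-- Two continuous functions which agree at all points `F_w (q 0)` are equal. -/
theorem ext_of_forall_wordMap {f g : C(SG q, ℝ)} (j : List (Fin 3) → SG q)
    (h : ∀ w, f (wordMap q w (j w)) = g (wordMap q w (j w))) : f = g := by
  ext x
  by_contra hne
  have hpos : 0 < |(f - g) x| := abs_pos.2 (by simpa [sub_eq_zero] using hne)
  obtain ⟨N, hN⟩ := exists_cell_osc_lt (f - g) hpos
  obtain ⟨w, hw, y, rfl⟩ := exists_wordMap_eq N x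
  have := hN w hw.ge y (j w)
  simp [h] at this

/-! ### Gluing -/

/-- Continuous functions on the three cells of level one which agree at the junction points are the
restrictions of a continuous function. -/
theorem exists_glue (hq : Equilateral q) (u : Fin 3 → C(SG q, ℝ))
    (h : ∀ i j, u i (bdry q j) = u j (bdry q i)) :
    ∃ v : C(SG q, ℝ), ∀ i x, v (F q i x) = u i x := by
  let π : C(Fin 3 × SG q, SG q) :=
    ⟨fun z => F q z.1 z.2, by
      refine continuous_prod_of_discrete_left.2 fun i => (F q i).continuous⟩
  -- A continuous surjection from a compact space onto a Hausdorff space is closed, hence a quotient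
  -- map, so continuity of the glued function comes for free.
  have hπ : IsQuotientMap π :=
    (π.continuous.isClosedMap).isQuotientMap π.continuous fun x => by
      obtain ⟨i, y, h⟩ := F_surjective x
      exact ⟨(i, y), h⟩
  let g : C(Fin 3 × SG q, ℝ) :=
    ⟨fun z => u z.1 z.2, continuous_prod_of_discrete_left.2 fun i => (u i).continuous⟩
  have hg : ∀ a b, π a = π b → g a = g b := by
    rintro ⟨i, x⟩ ⟨j, y⟩ (hxy : F q i x = F q j y)
    change u i x = u j y
    by_cases hij : i = j
    · subst hij; rw [F_injective hq i hxy]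
    · rw [eq_bdry_of_F_eq hq hij hxy, eq_bdry_of_F_eq hq (Ne.symm hij) hxy.symm, h]
  refine ⟨hπ.lift g (fun {a b} hab => hg a b hab), fun i x => ?_⟩
  exact DFunLike.congr_fun (hπ.lift_comp g (fun {a b} hab => hg a b hab)) (i, x)

/-! ### Reflection -/

/-- The transposition of the indices `1` and `2`. -/
def flip : Fin 3 → Fin 3 := ![0, 2, 1]

@[simp] theorem flip_flip (i : Fin 3) : flip (flip i) = i := by fin_cases i <;> rfl

/-- The affine map exchanging `q 1` and `q 2` acts on addresses letter by letter, so it preserves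
the gasket. -/
theorem exists_reflection (hq : Equilateral q) :
    ∃ σ : C(SG q, SG q), (∀ i, σ (bdry q i) = bdry q (flip i)) ∧
      (∀ i x, σ (F q i x) = F q (flip i) (σ x)) ∧ ∀ x, σ (σ x) = x := by
  have key : ∀ w : ℕ → Fin 3, ∑ i, bary q i (address q w) • q (flip i)
      = address q (fun n => flip (w n)) := by
    intro w
    refine (hasSum_sum fun i _ =>
      (hasSum_bary_address hq i w).smul_const (q (flip i))).unique ?_
    simpa using hasSum_address q (fun n => flip (w n))
  let σ : C(SG q, SG q) :=
    ⟨fun x => ⟨∑ i, coord q i x • q (flip i), by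
      obtain ⟨_, w, rfl⟩ := x
      exact ⟨_, (key w).symm⟩⟩, by
      refine Continuous.subtype_mk ?_ _
      exact continuous_finsetSum _ fun i _ => (continuous_coord i).smul continuous_const⟩
  have hif : ∀ i j : Fin 3, (flip i = j) = (i = flip j) := by decide
  have hσ : ∀ i x, coord q i (σ x) = coord q (flip i) x := by
    rintro i ⟨_, w, rfl⟩
    change bary q i (∑ i, bary q i (address q w) • q (flip i)) = bary q (flip i) (address q w)
    rw [key]
    refine (hasSum_bary_address hq i _).unique ?_
    simp only [← hif]
    exact hasSum_bary_address hq (flip i) w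
  refine ⟨σ, fun i => ext_coord hq fun k => ?_, fun i x => ext_coord hq fun k => ?_,
    fun x => ext_coord hq fun k => ?_⟩
  · simp only [hσ, coord_bdry hq, hif]
  · simp only [hσ, coord_F hq, hif]
  · simp only [hσ, flip_flip]

end Coord

/-! ### Vertices, cells, and the self-similarity of the graph Laplacian -/

section Graph

variable {q : Fin 3 → Plane}

theorem mem_V_zero {x : SG q} : x ∈ V q 0 ↔ ∃ i, bdry q i = x := by simp [V]

theorem bdry_mem_V_zero (i : Fin 3) : bdry q i ∈ V q 0 := mem_V_zero.2 ⟨i, rfl⟩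

theorem mem_V_succ {m : ℕ} {x : SG q} : x ∈ V q (m + 1) ↔ ∃ i, ∃ y ∈ V q m, F q i y = x := by
  simp [V]

theorem bdry_mem_V (m : ℕ) (i : Fin 3) : bdry q i ∈ V q m := by
  induction m with
  | zero => exact bdry_mem_V_zero i
  | succ m ih => exact mem_V_succ.2 ⟨i, _, ih, F_bdry_self i⟩

theorem V_zero_subset (m : ℕ) : V q 0 ⊆ V q m := fun x hx => by
  obtain ⟨i, rfl⟩ := mem_V_zero.1 hx
  exact bdry_mem_V m i

/-- A point of `F_i` that is also the image of a vertex under another `F_j` is a junction, and its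
preimage is a boundary point, which belongs to every `V_m`. -/
theorem F_mem_V_succ (hq : Equilateral q) {m : ℕ} {i : Fin 3} {x : SG q} :
    F q i x ∈ V q (m + 1) ↔ x ∈ V q m := by
  refine ⟨fun h => ?_, fun h => mem_V_succ.2 ⟨i, x, h, rfl⟩⟩
  obtain ⟨j, y, hy, hxy⟩ := mem_V_succ.1 h
  by_cases hij : j = i
  · subst hij; rwa [← F_injective hq _ hxy]
  · rw [eq_bdry_of_F_eq hq hij hxy]; exact bdry_mem_V m j

theorem V_subset_succ (m : ℕ) : V q m ⊆ V q (m + 1) := by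
  induction m with
  | zero => exact V_zero_subset 1
  | succ m ih =>
    intro x hx
    obtain ⟨i, y, hy, rfl⟩ := mem_V_succ.1 hx
    exact mem_V_succ.2 ⟨i, y, ih hy, rfl⟩

theorem not_mem_V_zero {x : SG q} (hx : x ∉ V q 0) (i : Fin 3) : x ≠ bdry q i :=
  fun h => hx (h ▸ bdry_mem_V_zero i)

theorem F_eq_F_iff (hq : Equilateral q) {i j : Fin 3} {x y : SG q} (hx : x ∉ V q 0) :
    F q i x = F q j y ↔ i = j ∧ x = y := by
  refine ⟨fun h => ?_, fun h => by rw [h.1, h.2]⟩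
  by_cases hij : i = j
  · subst hij; exact ⟨rfl, F_injective hq i h⟩
  · exact absurd (eq_bdry_of_F_eq hq (Ne.symm hij) h.symm) (not_mem_V_zero hx j)

theorem F_not_mem_V_zero (hq : Equilateral q) {i : Fin 3} {x : SG q} (hx : x ∉ V q 0) :
    F q i x ∉ V q 0 := fun h => by
  obtain ⟨j, hj⟩ := mem_V_zero.1 h
  exact not_mem_V_zero hx j (F_eq_bdry hq hj.symm).2

theorem F_bdry_not_mem_V_zero (hq : Equilateral q) {i j : Fin 3} (hij : i ≠ j) :
    F q i (bdry q j) ∉ V q 0 := fun h => by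
  obtain ⟨k, hk⟩ := mem_V_zero.1 h
  obtain ⟨h1, h2⟩ := F_eq_bdry hq hk.symm
  exact hij (h1.trans (bdry_injective hq h2).symm)

theorem wordMap_not_mem_V_zero (hq : Equilateral q) (w : List (Fin 3)) {x : SG q}
    (hx : x ∉ V q 0) : wordMap q w x ∉ V q 0 := by
  induction w with
  | nil => exact hx
  | cons i w ih => exact F_not_mem_V_zero hq ih

theorem wordMap_mem_V (w : List (Fin 3)) {m : ℕ} {x : SG q} (hx : x ∈ V q m) :
    wordMap q w x ∈ V q (m + w.length) := by
  induction w with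
  | nil => exact hx
  | cons i w ih => exact mem_V_succ.2 ⟨i, _, ih, rfl⟩

theorem sameCell_comm {m : ℕ} {x y : SG q} : SameCell q m x y ↔ SameCell q m y x :=
  ⟨fun ⟨w, h, hx, hy⟩ => ⟨w, h, hy, hx⟩, fun ⟨w, h, hx, hy⟩ => ⟨w, h, hy, hx⟩⟩

theorem sameCell_zero (x y : SG q) : SameCell q 0 x y := ⟨[], rfl, ⟨x, rfl⟩, ⟨y, rfl⟩⟩

theorem sameCell_succ {m : ℕ} {x y : SG q} : SameCell q (m + 1) x y ↔
    ∃ i x' y', SameCell q m x' y' ∧ F q i x' = x ∧ F q i y' = y := by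
  constructor
  · rintro ⟨_ | ⟨i, w⟩, hw, ⟨x', rfl⟩, ⟨y', rfl⟩⟩
    · simp at hw
    · exact ⟨i, _, _, ⟨w, by simpa using hw, ⟨x', rfl⟩, ⟨y', rfl⟩⟩, rfl, rfl⟩
  · rintro ⟨i, _, _, ⟨w, hw, ⟨x, rfl⟩, ⟨y, rfl⟩⟩, rfl, rfl⟩
    exact ⟨i :: w, by simp [hw], ⟨x, rfl⟩, ⟨y, rfl⟩⟩

open scoped Classical in
/-- The neighbours of a point in the graph of level `m`. -/
noncomputable def nbrs (q : Fin 3 → Plane) (m : ℕ) (x : SG q) : Finset (SG q) :=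
  (V q m).filter (fun y => y ≠ x ∧ SameCell q m x y)

theorem mem_nbrs {m : ℕ} {x y : SG q} :
    y ∈ nbrs q m x ↔ y ∈ V q m ∧ y ≠ x ∧ SameCell q m x y := by
  simp [nbrs]

theorem graphLaplacian_eq (m : ℕ) (u : SG q → ℝ) (x : SG q) :
    graphLaplacian q m u x = ∑ y ∈ nbrs q m x, (u y - u x) := rfl

theorem mem_nbrs_succ (hq : Equilateral q) {m : ℕ} {x y : SG q} :
    y ∈ nbrs q (m + 1) x ↔ ∃ i x' y', F q i x' = x ∧ F q i y' = y ∧ y' ∈ nbrs q m x' := by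
  simp only [mem_nbrs, sameCell_succ]
  constructor
  · rintro ⟨hy, hne, i, x', y', h, rfl, rfl⟩
    exact ⟨i, x', y', rfl, rfl, (F_mem_V_succ hq).1 hy, fun h => hne (by rw [h]), h⟩
  · rintro ⟨i, x', y', rfl, rfl, hy, hne, h⟩
    exact ⟨(F_mem_V_succ hq).2 hy, (F_injective hq i).ne hne, i, x', y', h, rfl, rfl⟩

theorem sum_image_F (hq : Equilateral q) [DecidableEq (SG q)] (i : Fin 3) (s : Finset (SG q))
    (g : SG q → ℝ) : ∑ y ∈ s.image (F q i), g y = ∑ y ∈ s, g (F q i y) :=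
  Finset.sum_image fun _ _ _ _ h => F_injective hq i h

theorem graphLaplacian_succ_of_unique (hq : Equilateral q) (m : ℕ) (u : SG q → ℝ) (i : Fin 3)
    (x : SG q) (h : ∀ j y, F q j y = F q i x → j = i ∧ y = x) :
    graphLaplacian q (m + 1) u (F q i x) = graphLaplacian q m (u ∘ F q i) x := by
  classical
  have : nbrs q (m + 1) (F q i x) = (nbrs q m x).image (F q i) := by
    ext y
    rw [mem_nbrs_succ hq, Finset.mem_image]
    constructor
    · rintro ⟨j, x', y', h1, rfl, hy⟩
      obtain ⟨rfl, rfl⟩ := h _ _ h1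
      exact ⟨y', hy, rfl⟩
    · rintro ⟨y', hy, rfl⟩
      exact ⟨i, x, y', rfl, rfl, hy⟩
  rw [graphLaplacian_eq, this, sum_image_F hq, graphLaplacian_eq]
  rfl

theorem graphLaplacian_succ_interior (hq : Equilateral q) (m : ℕ) (u : SG q → ℝ) (i : Fin 3)
    {x : SG q} (hx : x ∉ V q 0) :
    graphLaplacian q (m + 1) u (F q i x) = graphLaplacian q m (u ∘ F q i) x :=
  graphLaplacian_succ_of_unique hq m u i x fun j y h => by
    obtain ⟨h1, h2⟩ := (F_eq_F_iff hq hx).1 h.symm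
    exact ⟨h1.symm, h2.symm⟩

theorem graphLaplacian_succ_bdry (hq : Equilateral q) (m : ℕ) (u : SG q → ℝ) (i : Fin 3) :
    graphLaplacian q (m + 1) u (bdry q i) = graphLaplacian q m (u ∘ F q i) (bdry q i) := by
  conv_lhs => rw [← F_bdry_self i]
  refine graphLaplacian_succ_of_unique hq m u i _ fun j y h => ?_
  rw [F_bdry_self] at h
  exact F_eq_bdry hq h

/-- The neighbours lie in the two cells that contain the junction; these share no other point, so
the sum splits. -/
theorem graphLaplacian_succ_junction (hq : Equilateral q) (m : ℕ) (u : SG q → ℝ) {i j : Fin 3}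
    (hij : i ≠ j) : graphLaplacian q (m + 1) u (F q i (bdry q j))
      = graphLaplacian q m (u ∘ F q i) (bdry q j) + graphLaplacian q m (u ∘ F q j) (bdry q i) := by
  classical
  have : nbrs q (m + 1) (F q i (bdry q j)) = (nbrs q m (bdry q j)).image (F q i)
      ∪ (nbrs q m (bdry q i)).image (F q j) := by
    ext y
    rw [mem_nbrs_succ hq, Finset.mem_union, Finset.mem_image, Finset.mem_image]
    constructor
    · rintro ⟨k, x', y', h1, rfl, hy⟩
      by_cases hk : k = i
      · subst hk
        rw [F_injective hq _ h1] at hy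
        exact Or.inl ⟨y', hy, rfl⟩
      · have := bdry_injective hq (eq_bdry_of_F_eq hq hk h1)
        subst this
        rw [F_bdry_comm] at h1
        rw [F_injective hq _ h1] at hy
        exact Or.inr ⟨y', hy, rfl⟩
    · rintro (⟨y', hy, rfl⟩ | ⟨y', hy, rfl⟩)
      · exact ⟨i, _, y', rfl, rfl, hy⟩
      · exact ⟨j, _, y', F_bdry_comm j i, rfl, hy⟩
  rw [graphLaplacian_eq, this, Finset.sum_union, sum_image_F hq, sum_image_F hq, graphLaplacian_eq,
    graphLaplacian_eq]
  · simp only [Function.comp_apply, F_bdry_comm i j]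
  · rw [Finset.disjoint_left]
    intro y hy hy'
    obtain ⟨a, ha, rfl⟩ := Finset.mem_image.1 hy
    obtain ⟨b, hb, hab⟩ := Finset.mem_image.1 hy'
    exact (mem_nbrs.1 ha).2.1 (eq_bdry_of_F_eq hq (Ne.symm hij) hab)

theorem graphLaplacian_zero_bdry (hq : Equilateral q) (u : SG q → ℝ) (i : Fin 3) :
    graphLaplacian q 0 u (bdry q i) = ∑ j, u (bdry q j) - 3 * u (bdry q i) := by
  classical
  have : nbrs q 0 (bdry q i) = (Finset.univ.erase i).image (bdry q) := by
    ext y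
    simp only [mem_nbrs, mem_V_zero, Finset.mem_image, Finset.mem_erase, Finset.mem_univ, and_true]
    constructor
    · rintro ⟨⟨k, rfl⟩, h, -⟩
      exact ⟨k, fun hk => h (by rw [hk]), rfl⟩
    · rintro ⟨k, hk, rfl⟩
      exact ⟨⟨k, rfl⟩, (bdry_injective hq).ne hk, sameCell_zero _ _⟩
  rw [graphLaplacian_eq, this, Finset.sum_image fun _ _ _ _ h => bdry_injective hq h,
    Finset.sum_erase _ (by simp), Finset.sum_sub_distrib]
  simp

/-- A point of `V_{m+1}` is a boundary point, the junction point of two cells of level one, or the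
image of a point of `V_m` which is not a boundary point. -/
theorem V_succ_cases {m : ℕ} {x : SG q} (hx : x ∈ V q (m + 1)) (hx0 : x ∉ V q 0) :
    (∃ i y, y ∈ V q m ∧ y ∉ V q 0 ∧ F q i y = x) ∨ ∃ i j, i ≠ j ∧ F q i (bdry q j) = x := by
  obtain ⟨i, y, hy, rfl⟩ := mem_V_succ.1 hx
  by_cases h : y ∈ V q 0
  · obtain ⟨j, rfl⟩ := mem_V_zero.1 h
    refine Or.inr ⟨i, j, fun hij => hx0 ?_, rfl⟩
    subst hij
    rw [F_bdry_self]; exact h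
  · exact Or.inl ⟨i, y, hy, h, rfl⟩

theorem graphLaplacian_add (m : ℕ) (u v : SG q → ℝ) (x : SG q) :
    graphLaplacian q m (u + v) x = graphLaplacian q m u x + graphLaplacian q m v x := by
  simp only [graphLaplacian_eq, ← Finset.sum_add_distrib, Pi.add_apply]
  exact Finset.sum_congr rfl fun y _ => by ring

theorem graphLaplacian_smul (m : ℕ) (a : ℝ) (u : SG q → ℝ) (x : SG q) :
    graphLaplacian q m (a • u) x = a * graphLaplacian q m u x := by
  simp only [graphLaplacian_eq, Finset.mul_sum, Pi.smul_apply, smul_eq_mul]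
  exact Finset.sum_congr rfl fun y _ => by ring

/-! ### Algebra of the Laplacian -/

theorem HasLaplacian.add {u v f g : C(SG q, ℝ)} (hu : HasLaplacian q u f)
    (hv : HasLaplacian q v g) : HasLaplacian q (u + v) (f + g) := by
  intro ε hε
  obtain ⟨N, hN⟩ := hu (ε / 2) (by positivity)
  obtain ⟨M, hM⟩ := hv (ε / 2) (by positivity)
  refine ⟨max N M, fun m hm x hx hx0 => ?_⟩
  have h1 := hN m (le_of_max_le_left hm) x hx hx0
  have h2 := hM m (le_of_max_le_right hm) x hx hx0
  rw [ContinuousMap.coe_add, graphLaplacian_add, ContinuousMap.add_apply]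
  rw [abs_lt] at *
  constructor <;> nlinarith

theorem HasLaplacian.smul {u f : C(SG q, ℝ)} (a : ℝ) (hu : HasLaplacian q u f) :
    HasLaplacian q (a • u) (a • f) := by
  intro ε hε
  obtain ⟨N, hN⟩ := hu (ε / (|a| + 1)) (by positivity)
  refine ⟨N, fun m hm x hx hx0 => ?_⟩
  have h1 := hN m hm x hx hx0
  rw [ContinuousMap.coe_smul, graphLaplacian_smul, ContinuousMap.smul_apply, smul_eq_mul]
  have : 3 / 2 * 5 ^ m * (a * graphLaplacian q m u x) - a * f x
      = a * (3 / 2 * 5 ^ m * graphLaplacian q m u x - f x) := by ring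
  rw [this, abs_mul]
  rw [lt_div_iff₀ (by positivity)] at h1
  nlinarith [abs_nonneg (3 / 2 * 5 ^ m * graphLaplacian q m u x - f x)]

theorem HasLaplacian.sub {u v f g : C(SG q, ℝ)} (hu : HasLaplacian q u f)
    (hv : HasLaplacian q v g) : HasLaplacian q (u - v) (f - g) := by
  have := hu.add (hv.smul (-1))
  simpa [sub_eq_add_neg] using this

theorem HasLaplacian.zero : HasLaplacian q (0 : C(SG q, ℝ)) 0 := by
  intro ε hε
  refine ⟨0, fun m _ x _ _ => ?_⟩
  simpa [graphLaplacian_eq] using hε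

theorem HasLaplacian.sum {ι : Type*} (s : Finset ι) {u f : ι → C(SG q, ℝ)}
    (h : ∀ i ∈ s, HasLaplacian q (u i) (f i)) : HasLaplacian q (∑ i ∈ s, u i) (∑ i ∈ s, f i) := by
  classical
  induction s using Finset.induction_on with
  | empty => simpa using HasLaplacian.zero
  | insert a s ha ih =>
    rw [Finset.sum_insert ha, Finset.sum_insert ha]
    exact (h a (Finset.mem_insert_self a s)).add
      (ih fun i hi => h i (Finset.mem_insert_of_mem hi))

/-- The scaling law of the Laplacian. -/
theorem HasLaplacian.comp_F (hq : Equilateral q) {u f : C(SG q, ℝ)} (hu : HasLaplacian q u f)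
    (i : Fin 3) : HasLaplacian q (u.comp (F q i)) ((1 / 5 : ℝ) • f.comp (F q i)) := by
  intro ε hε
  obtain ⟨N, hN⟩ := hu (5 * ε) (by positivity)
  refine ⟨N, fun m hm x hx hx0 => ?_⟩
  have h := hN (m + 1) (by omega) (F q i x) ((F_mem_V_succ hq).2 hx) (F_not_mem_V_zero hq hx0)
  rw [graphLaplacian_succ_interior hq m u i hx0] at h
  rw [ContinuousMap.coe_comp, ContinuousMap.smul_apply, ContinuousMap.comp_apply, smul_eq_mul]
  have e : 3 / 2 * 5 ^ (m + 1) * graphLaplacian q m (u ∘ F q i) x - f (F q i x)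
      = 5 * (3 / 2 * 5 ^ m * graphLaplacian q m (u ∘ F q i) x - 1 / 5 * f (F q i x)) := by ring
  rw [e, abs_mul, abs_of_pos (by norm_num : (0 : ℝ) < 5)] at h
  linarith

/-- A function has at most one Laplacian. -/
theorem HasLaplacian.eq_zero (hq : Equilateral q) {f : C(SG q, ℝ)} (h : HasLaplacian q 0 f) :
    f = 0 := by
  have key : ∀ m, ∀ x ∈ V q m, x ∉ V q 0 → f x = 0 := by
    intro m x hx hx0
    by_contra hne
    obtain ⟨N, hN⟩ := h |f x| (abs_pos.2 hne)
    have hmono : ∀ k, x ∈ V q (m + k) := by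
      intro k
      induction k with
      | zero => exact hx
      | succ k ih => exact V_subset_succ _ ih
    have := hN (m + N) (by omega) x (hmono N) hx0
    simp [graphLaplacian_eq] at this
  -- The convergence says nothing on `V_0`, so the test point in each cell is a midpoint instead of
  -- a corner.
  refine ext_of_forall_wordMap (fun _ => F q 0 (bdry q 1)) fun w => ?_
  refine key (1 + w.length) _ (wordMap_mem_V w (mem_V_succ.2 ⟨0, _, bdry_mem_V 0 1, rfl⟩)) ?_
  exact wordMap_not_mem_V_zero hq w (F_bdry_not_mem_V_zero hq (by decide))

/-- Invariance of the Laplacian under symmetries of the gasket. -/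
theorem HasLaplacian.comp_symm {σ : C(SG q, SG q)} {τ : Fin 3 → Fin 3}
    (hb : ∀ i, σ (bdry q i) = bdry q (τ i))
    (hF : ∀ i x, σ (F q i x) = F q (τ i) (σ x)) (hσ : ∀ x, σ (σ x) = x) {u f : C(SG q, ℝ)}
    (hu : HasLaplacian q u f) : HasLaplacian q (u.comp σ) (f.comp σ) := by
  classical
  have hV : ∀ m x, x ∈ V q m → σ x ∈ V q m := by
    intro m
    induction m with
    | zero =>
      intro x hx
      obtain ⟨i, rfl⟩ := mem_V_zero.1 hx
      rw [hb]; exact bdry_mem_V_zero _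
    | succ m ih =>
      intro x hx
      obtain ⟨i, y, hy, rfl⟩ := mem_V_succ.1 hx
      exact mem_V_succ.2 ⟨τ i, σ y, ih y hy, (hF i y).symm⟩
  have hC : ∀ m x y, SameCell q m x y → SameCell q m (σ x) (σ y) := by
    intro m
    induction m with
    | zero => intro x y _; exact sameCell_zero _ _
    | succ m ih =>
      intro x y h
      obtain ⟨i, x', y', h', rfl, rfl⟩ := sameCell_succ.1 h
      exact sameCell_succ.2 ⟨τ i, _, _, ih _ _ h', (hF i x').symm, (hF i y').symm⟩
  have hinj : Function.Injective σ := fun x y h => by rw [← hσ x, h, hσ]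
  have hN : ∀ m x y, y ∈ nbrs q m x → σ y ∈ nbrs q m (σ x) := by
    intro m x y hy
    obtain ⟨h1, h2, h3⟩ := mem_nbrs.1 hy
    exact mem_nbrs.2 ⟨hV m y h1, hinj.ne h2, hC m x y h3⟩
  have hL : ∀ m x, graphLaplacian q m (u ∘ σ) x = graphLaplacian q m u (σ x) := by
    intro m x
    rw [graphLaplacian_eq, graphLaplacian_eq]
    refine Finset.sum_bij' (fun y _ => σ y) (fun y _ => σ y) (hN m x) (fun y hy => ?_)
      (fun y _ => hσ y) (fun y _ => hσ y) (fun y _ => rfl)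
    simpa [hσ] using hN m (σ x) y hy
  intro ε hε
  obtain ⟨N, h⟩ := hu ε hε
  refine ⟨N, fun m hm x hx hx0 => ?_⟩
  rw [ContinuousMap.coe_comp, hL, ContinuousMap.comp_apply]
  refine h m hm (σ x) (hV m x hx) fun h0 => hx0 ?_
  simpa [hσ] using hV 0 _ h0

end Graph

/-! ### Harmonic functions -/

/-- The harmonic extension rule: boundary values on the cell `F_i` of the harmonic function with
boundary values `a`. -/
noncomputable def rule (i : Fin 3) (a : Fin 3 → ℝ) (j : Fin 3) : ℝ :=
  if i = j then a i else (a i + a j + ∑ k, a k) / 5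

theorem rule_self (i : Fin 3) (a : Fin 3 → ℝ) : rule i a i = a i := by simp [rule]

theorem rule_comm (i j : Fin 3) (a : Fin 3 → ℝ) : rule i a j = rule j a i := by
  by_cases h : i = j
  · rw [h]
  · rw [rule, rule, if_neg h, if_neg (Ne.symm h), add_comm (a i)]

theorem rule_add (i : Fin 3) (a b : Fin 3 → ℝ) (j : Fin 3) :
    rule i (a + b) j = rule i a j + rule i b j := by
  simp only [rule, Pi.add_apply, Finset.sum_add_distrib]
  split_ifs
  · rfl
  · ring

theorem rule_smul (i : Fin 3) (c : ℝ) (a : Fin 3 → ℝ) (j : Fin 3) :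
    rule i (c • a) j = c * rule i a j := by
  simp only [rule, Pi.smul_apply, smul_eq_mul, ← Finset.mul_sum]
  split_ifs
  · rfl
  · ring

/-- Each new value is `2/5 a i` plus `3/5` of a convex combination of boundary values, so the range
of the data shrinks by `3/5` in a cell. This contraction makes the iterated extension converge. -/
theorem rule_mem_Icc {a : Fin 3 → ℝ} {l r : ℝ} (h : ∀ k, a k ∈ Set.Icc l (l + r)) (i j : Fin 3) :
    rule i a j ∈ Set.Icc (2 / 5 * a i + 3 / 5 * l) (2 / 5 * a i + 3 / 5 * l + 3 / 5 * r) := by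
  have h0 := h 0
  have h1 := h 1
  have h2 := h 2
  simp only [Set.mem_Icc, rule, Fin.sum_univ_three] at *
  fin_cases i <;> fin_cases j <;> simp <;> constructor <;> linarith

section Harmonic

variable {q : Fin 3 → Plane}

/-- A function on the gasket is harmonic if it obeys the harmonic extension rule in every cell. -/
def IsHarm (q : Fin 3 → Plane) (u : SG q → ℝ) : Prop :=
  ∀ (w : List (Fin 3)) (i j : Fin 3), u (wordMap q w (F q i (bdry q j)))
    = rule i (fun k => u (wordMap q w (bdry q k))) j

theorem IsHarm.F_bdry {u : SG q → ℝ} (hu : IsHarm q u) (i j : Fin 3) :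
    u (F q i (bdry q j)) = rule i (fun k => u (bdry q k)) j := hu [] i j

theorem IsHarm.comp_F {u : SG q → ℝ} (hu : IsHarm q u) (i : Fin 3) : IsHarm q (u ∘ F q i) :=
  fun w => hu (i :: w)

theorem IsHarm.add {u v : SG q → ℝ} (hu : IsHarm q u) (hv : IsHarm q v) : IsHarm q (u + v) := by
  intro w i j
  rw [Pi.add_apply, hu, hv, ← rule_add]
  rfl

theorem IsHarm.smul {u : SG q → ℝ} (c : ℝ) (hu : IsHarm q u) : IsHarm q (c • u) := by
  intro w i j
  rw [Pi.smul_apply, hu, smul_eq_mul, ← rule_smul]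
  rfl

theorem IsHarm.sub {u v : SG q → ℝ} (hu : IsHarm q u) (hv : IsHarm q v) : IsHarm q (u - v) := by
  have := hu.add (hv.smul (-1))
  simpa [sub_eq_add_neg] using this

theorem isHarm_const (c : ℝ) : IsHarm q (fun _ => c) := by
  intro w i j
  simp only [rule, Fin.sum_univ_three]
  split_ifs
  · rfl
  · ring

theorem IsHarm.zero : IsHarm q (0 : SG q → ℝ) := isHarm_const 0

theorem IsHarm.sum {ι : Type*} (s : Finset ι) {u : ι → SG q → ℝ} (h : ∀ i ∈ s, IsHarm q (u i)) :
    IsHarm q (∑ i ∈ s, u i) := by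
  classical
  induction s using Finset.induction_on with
  | empty => simpa using IsHarm.zero
  | insert a s ha ih =>
    rw [Finset.sum_insert ha]
    exact (h a (Finset.mem_insert_self a s)).add
      (ih fun i hi => h i (Finset.mem_insert_of_mem hi))

/-- The values of a harmonic function at the corners of cells lie between its boundary values. -/
theorem IsHarm.wordMap_mem_Icc {u : SG q → ℝ} (hu : IsHarm q u) {l r : ℝ}
    (h : ∀ k, u (bdry q k) ∈ Set.Icc l r) (w : List (Fin 3)) (k : Fin 3) :
    u (wordMap q w (bdry q k)) ∈ Set.Icc l r := by
  induction w generalizing u with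
  | nil => exact h k
  | cons i w ih =>
    refine ih (hu.comp_F i) fun j => ?_
    rw [Function.comp_apply, hu.F_bdry]
    have h0 := h 0
    have h1 := h 1
    have h2 := h 2
    simp only [Set.mem_Icc, rule, Fin.sum_univ_three] at *
    fin_cases i <;> fin_cases j <;> simp <;> constructor <;> linarith

/-- The maximum principle. -/
theorem IsHarm.mem_Icc {u : C(SG q, ℝ)} (hu : IsHarm q u) {l r : ℝ}
    (h : ∀ k, u (bdry q k) ∈ Set.Icc l r) (x : SG q) : u x ∈ Set.Icc l r := by
  have key : ∀ ε > 0, l - ε ≤ u x ∧ u x ≤ r + ε := by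
    intro ε hε
    obtain ⟨N, hN⟩ := exists_cell_osc_lt u hε
    obtain ⟨w, hw, y, rfl⟩ := exists_wordMap_eq N x
    have h1 := abs_lt.1 (hN w hw.ge y (bdry q 0))
    have h2 := hu.wordMap_mem_Icc h w 0
    constructor <;> linarith [h2.1, h2.2]
  constructor
  · exact le_of_forall_pos_sub_le fun ε hε => (key ε hε).1
  · exact le_of_forall_pos_le_add fun ε hε => (key ε hε).2

theorem IsHarm.ext {u v : C(SG q, ℝ)} (hu : IsHarm q u) (hv : IsHarm q v)
    (h : ∀ k, u (bdry q k) = v (bdry q k)) : u = v := by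
  have hd : IsHarm q (u - v : C(SG q, ℝ)) := hu.sub hv
  ext x
  have := hd.mem_Icc (l := 0) (r := 0) (fun k => by simp [h]) x
  simp only [ContinuousMap.sub_apply, Set.Icc_self, Set.mem_singleton_iff] at this
  linarith

/-- The harmonic functions are the limits of the iterates of the extension rule. -/
theorem exists_isHarm (hq : Equilateral q) (a : Fin 3 → ℝ) :
    ∃ u : C(SG q, ℝ), IsHarm q u ∧ ∀ k, u (bdry q k) = a k := by
  -- One refinement: `rule_comm` says that the extension rule gives the same value from both sides
  -- of a junction, so the three pieces glue.
  have hstep : ∀ g : {g : (Fin 3 → ℝ) → C(SG q, ℝ) // ∀ a j, g a (bdry q j) = a j},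
      ∃ g' : {g : (Fin 3 → ℝ) → C(SG q, ℝ) // ∀ a j, g a (bdry q j) = a j},
        ∀ a i x, g'.1 a (F q i x) = g.1 (rule i a) x := by
    rintro ⟨g, hg⟩
    choose g' hg' using fun a => exists_glue hq (fun i => g (rule i a)) fun i j => by
      rw [hg, hg, rule_comm]
    refine ⟨⟨g', fun a j => ?_⟩, hg'⟩
    rw [← F_bdry_self j, hg', hg, rule_self]
  choose step hstep using hstep
  let g0 : (Fin 3 → ℝ) → C(SG q, ℝ) := fun a =>
    ⟨fun x => ∑ i, a i * coord q i x,
      continuous_finsetSum _ fun i _ => continuous_const.mul (continuous_coord i)⟩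
  have hg0 : ∀ a j, g0 a (bdry q j) = a j := fun a j => by
    change ∑ i, a i * coord q i (bdry q j) = a j
    simp [coord_bdry hq]
  let h : ℕ → {g : (Fin 3 → ℝ) → C(SG q, ℝ) // ∀ a j, g a (bdry q j) = a j} :=
    fun n => Nat.rec ⟨g0, hg0⟩ (fun _ g => step g) n
  have hh : ∀ n a i x, (h (n + 1)).1 a (F q i x) = (h n).1 (rule i a) x := fun n => hstep (h n)
  have hg0I : ∀ (a : Fin 3 → ℝ) (l r : ℝ), (∀ k, a k ∈ Set.Icc l r) →
      ∀ x, g0 a x ∈ Set.Icc l r := by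
    intro a l r ha x
    have hs := sum_coord hq x
    have hn := fun i => coord_nonneg hq i x
    change ∑ i, a i * coord q i x ∈ Set.Icc l r
    constructor
    · calc l = ∑ i, l * coord q i x := by rw [← Finset.mul_sum, hs, mul_one]
        _ ≤ _ := Finset.sum_le_sum fun i _ => mul_le_mul_of_nonneg_right (ha i).1 (hn i)
    · calc _ ≤ ∑ i, r * coord q i x :=
            Finset.sum_le_sum fun i _ => mul_le_mul_of_nonneg_right (ha i).2 (hn i)
        _ = r := by rw [← Finset.mul_sum, hs, mul_one]
  -- The starting function and its refinement both stay within the range of the data, and each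
  -- further level multiplies the length of that range by `3/5`.
  have hbound : ∀ n (a : Fin 3 → ℝ) (l r : ℝ), (∀ k, a k ∈ Set.Icc l (l + r)) →
      ∀ x, |(h n).1 a x - (h (n + 1)).1 a x| ≤ r * (3 / 5) ^ n := by
    intro n
    induction n with
    | zero =>
      intro a l r ha x
      have h1 := hg0I a l (l + r) ha x
      obtain ⟨i, y, rfl⟩ := F_surjective x
      have h2 := hg0I (rule i a) l (l + r) (fun k => by
        have h0 := ha 0
        have h1 := ha 1
        have h2 := ha 2
        simp only [Set.mem_Icc, rule, Fin.sum_univ_three] at *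
        fin_cases i <;> fin_cases k <;> simp <;> constructor <;> linarith) y
      rw [hh]
      change |g0 a (F q i y) - g0 (rule i a) y| ≤ _
      rw [abs_le]
      constructor <;> linarith [h1.1, h1.2, h2.1, h2.2]
    | succ n ih =>
      intro a l r ha x
      obtain ⟨i, y, rfl⟩ := F_surjective x
      rw [hh n, hh (n + 1)]
      refine (ih _ _ _ (rule_mem_Icc ha i) y).trans (le_of_eq ?_)
      rw [pow_succ]; ring
  have hcau : ∀ a, CauchySeq fun n => (h n).1 a := by
    intro a
    set l := - ∑ k, |a k| with hl
    set r := 2 * ∑ k, |a k| with hr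
    have hr0 : 0 ≤ r := by positivity
    refine cauchySeq_of_le_geometric (3 / 5) r (by norm_num) fun n => ?_
    rw [ContinuousMap.dist_le (by positivity)]
    intro x
    rw [Real.dist_eq]
    refine hbound n a l r (fun k => ?_) x
    have hk : |a k| ≤ ∑ k, |a k| :=
      Finset.single_le_sum (f := fun k => |a k|) (fun _ _ => abs_nonneg _) (Finset.mem_univ k)
    have := abs_le.1 hk
    constructor <;> linarith
  choose H hH using fun a => cauchySeq_tendsto_of_complete (hcau a)
  have hHx : ∀ a x, Tendsto (fun n => (h n).1 a x) atTop (𝓝 (H a x)) := fun a x =>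
    ((continuous_eval_const (F := C(SG q, ℝ)) x).tendsto (H a)).comp (hH a)
  have hHb : ∀ a k, H a (bdry q k) = a k := fun a k =>
    tendsto_nhds_unique (hHx a _) (by simp only [(h _).2]; exact tendsto_const_nhds)
  have hHF : ∀ a i x, H a (F q i x) = H (rule i a) x := fun a i x =>
    tendsto_nhds_unique ((hHx a _).comp (tendsto_add_atTop_nat 1)) (by
      simp only [Function.comp_def, hh]; exact hHx _ _)
  refine ⟨H a, ?_, hHb a⟩
  intro w
  induction w generalizing a with
  | nil =>
    intro i j
    simp only [wordMap_nil, hHF, hHb]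
  | cons i w ih =>
    intro j k
    simp only [wordMap_cons, hHF]
    exact ih (rule i a) j k

/-- The harmonic function with boundary values `a`. -/
noncomputable def harm (hq : Equilateral q) (a : Fin 3 → ℝ) : C(SG q, ℝ) :=
  Classical.choose (exists_isHarm hq a)

theorem isHarm_harm (hq : Equilateral q) (a : Fin 3 → ℝ) : IsHarm q (harm hq a) :=
  (Classical.choose_spec (exists_isHarm hq a)).1

theorem harm_bdry (hq : Equilateral q) (a : Fin 3 → ℝ) (k : Fin 3) :
    harm hq a (bdry q k) = a k := (Classical.choose_spec (exists_isHarm hq a)).2 k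

theorem harm_comp_F (hq : Equilateral q) (a : Fin 3 → ℝ) (i : Fin 3) :
    (harm hq a).comp (F q i) = harm hq (rule i a) := by
  refine IsHarm.ext ((isHarm_harm hq a).comp_F i) (isHarm_harm hq _) fun k => ?_
  rw [ContinuousMap.comp_apply, (isHarm_harm hq a).F_bdry, harm_bdry]
  simp only [harm_bdry]

theorem harm_smul (hq : Equilateral q) (c : ℝ) (a : Fin 3 → ℝ) :
    harm hq (c • a) = c • harm hq a :=
  IsHarm.ext (isHarm_harm hq _) ((isHarm_harm hq a).smul c) fun k => by
    simp [harm_bdry]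

/-! ### Harmonic functions and the Laplacian -/

/-- Restriction to the cell at `q i` multiplies the sum of differences at `q i` by `3/5`, directly
from the extension rule. -/
theorem IsHarm.graphLaplacian_bdry (hq : Equilateral q) {u : SG q → ℝ} (hu : IsHarm q u) (m : ℕ)
    (i : Fin 3) : graphLaplacian q m u (bdry q i)
      = (3 / 5) ^ m * (∑ j, u (bdry q j) - 3 * u (bdry q i)) := by
  induction m generalizing u with
  | zero => rw [graphLaplacian_zero_bdry hq]; ring
  | succ m ih =>
    rw [graphLaplacian_succ_bdry hq, ih (hu.comp_F i), pow_succ, mul_assoc]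
    congr 1
    simp only [Function.comp_apply, hu.F_bdry, rule, Fin.sum_univ_three]
    fin_cases i <;> simp <;> ring

/-- At a junction the contributions of the two cells cancel, which is what determines the
coefficients of the extension rule; elsewhere one descends into a cell. -/
theorem IsHarm.graphLaplacian_eq_zero (hq : Equilateral q) {u : SG q → ℝ} (hu : IsHarm q u)
    {m : ℕ} {x : SG q} (hx : x ∈ V q m) (hx0 : x ∉ V q 0) : graphLaplacian q m u x = 0 := by
  induction m generalizing u x with
  | zero => exact absurd hx hx0
  | succ m ih =>
    obtain ⟨i, y, hy, hy0, rfl⟩ | ⟨i, j, hij, rfl⟩ := V_succ_cases hx hx0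
    · rw [graphLaplacian_succ_interior hq m u i hy0, ih (hu.comp_F i) hy hy0]
    · rw [graphLaplacian_succ_junction hq m u hij, (hu.comp_F i).graphLaplacian_bdry hq,
        (hu.comp_F j).graphLaplacian_bdry hq, ← mul_add]
      convert mul_zero _
      simp only [Function.comp_apply, hu.F_bdry, rule, Fin.sum_univ_three]
      fin_cases i <;> fin_cases j <;> simp at hij ⊢ <;> ring

theorem IsHarm.hasLaplacian_zero (hq : Equilateral q) {u : C(SG q, ℝ)} (hu : IsHarm q u) :
    HasLaplacian q u 0 := by
  intro ε hε
  refine ⟨0, fun m _ x hx hx0 => ?_⟩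
  rw [hu.graphLaplacian_eq_zero hq hx hx0]
  simpa using hε

/-- Passing to a coarser graph increases the graph Laplacian at most by the factor `5/3` at the
boundary points, up to the values at the other vertices. -/
theorem abs_graphLaplacian_bdry_sub_le (hq : Equilateral q) {ε : ℝ} (m : ℕ) (u : SG q → ℝ)
    (h : ∀ x ∈ V q (m + 1), x ∉ V q 0 → |graphLaplacian q (m + 1) u x| ≤ ε) (i : Fin 3) :
    |graphLaplacian q m u (bdry q i) - 5 / 3 * graphLaplacian q (m + 1) u (bdry q i)|
      ≤ 5 / 3 * ε := by
  induction m generalizing u with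
  | zero =>
    -- The difference to be bounded is a combination of the Laplacians at the three midpoints, with
    -- weight `2/3` at the two midpoints adjacent to `q i` and `1/3` at the opposite one. The
    -- weights sum to `5/3`.
    have key : ∀ i j, i ≠ j → |graphLaplacian q 0 (u ∘ F q i) (bdry q j)
        + graphLaplacian q 0 (u ∘ F q j) (bdry q i)| ≤ ε := by
      intro i j hij
      rw [← graphLaplacian_succ_junction hq 0 u hij]
      exact h _ ((F_mem_V_succ hq).2 (bdry_mem_V 0 j)) (F_bdry_not_mem_V_zero hq hij)
    have k01 := abs_le.1 (key 0 1 (by decide))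
    have k02 := abs_le.1 (key 0 2 (by decide))
    have k12 := abs_le.1 (key 1 2 (by decide))
    rw [graphLaplacian_succ_bdry hq]
    simp only [graphLaplacian_zero_bdry hq, Function.comp_apply, Fin.sum_univ_three, F_bdry_self,
      F_bdry_comm (q := q) 1 0, F_bdry_comm (q := q) 2 0, F_bdry_comm (q := q) 2 1]
      at k01 k02 k12 ⊢
    rw [abs_le]
    fin_cases i <;> simp only [Fin.mk_zero, Fin.mk_one, Fin.reduceFinMk, F_bdry_self,
      F_bdry_comm (q := q) 1 0, F_bdry_comm (q := q) 2 0, F_bdry_comm (q := q) 2 1] <;>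
      constructor <;> linarith [k01.1, k01.2, k02.1, k02.2, k12.1, k12.2]
  | succ m ih =>
    rw [graphLaplacian_succ_bdry hq, graphLaplacian_succ_bdry hq (m + 1)]
    refine ih _ fun x hx hx0 => ?_
    rw [← graphLaplacian_succ_interior hq _ u i hx0]
    exact h _ ((F_mem_V_succ hq).2 hx) (F_not_mem_V_zero hq hx0)

/-- At a junction each of the two cells contributes an error `5/3 ε`, and `5/3` times the finer
Laplacian a third one; together `5 ε`. The factor agrees with the renormalization `5^m` of the
Laplacian. -/
theorem abs_graphLaplacian_le (hq : Equilateral q) {ε : ℝ} (m : ℕ) (u : SG q → ℝ)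
    (h : ∀ x ∈ V q (m + 1), x ∉ V q 0 → |graphLaplacian q (m + 1) u x| ≤ ε) {x : SG q}
    (hx : x ∈ V q m) (hx0 : x ∉ V q 0) : |graphLaplacian q m u x| ≤ 5 * ε := by
  induction m generalizing u x with
  | zero => exact absurd hx hx0
  | succ m ih =>
    have hF : ∀ i, ∀ x ∈ V q (m + 1), x ∉ V q 0 →
        |graphLaplacian q (m + 1) (u ∘ F q i) x| ≤ ε := by
      intro i x hx hx0
      rw [← graphLaplacian_succ_interior hq _ u i hx0]
      exact h _ ((F_mem_V_succ hq).2 hx) (F_not_mem_V_zero hq hx0)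
    have hxs := V_subset_succ _ hx
    obtain ⟨i, y, hy, hy0, rfl⟩ | ⟨i, j, hij, rfl⟩ := V_succ_cases hx hx0
    · rw [graphLaplacian_succ_interior hq m u i hy0]
      exact ih _ (hF i) hy hy0
    · have h3 := h _ hxs hx0
      rw [graphLaplacian_succ_junction hq _ u hij] at h3 ⊢
      have h1 := abs_le.1 (abs_graphLaplacian_bdry_sub_le hq m (u ∘ F q i) (hF i) j)
      have h2 := abs_le.1 (abs_graphLaplacian_bdry_sub_le hq m (u ∘ F q j) (hF j) i)
      rw [abs_le] at h3 ⊢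
      constructor <;> linarith [h1.1, h1.2, h2.1, h2.2, h3.1, h3.2]

/-- A function with vanishing Laplacian is harmonic. -/
theorem HasLaplacian.isHarm (hq : Equilateral q) {u : C(SG q, ℝ)} (hu : HasLaplacian q u 0) :
    IsHarm q u := by
  have hdesc : ∀ n m (ε : ℝ),
      (∀ x ∈ V q (m + n), x ∉ V q 0 → |graphLaplacian q (m + n) u x| ≤ ε) →
      ∀ x ∈ V q m, x ∉ V q 0 → |graphLaplacian q m u x| ≤ 5 ^ n * ε := by
    intro n
    induction n with
    | zero => intro m ε h; simpa using h
    | succ n ih =>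
      intro m ε h x hx hx0
      have := ih m (5 * ε) (fun x hx hx0 => abs_graphLaplacian_le hq (m + n) u h hx hx0) x hx hx0
      rw [pow_succ]; linarith
  have hzero : ∀ m, ∀ x ∈ V q m, x ∉ V q 0 → graphLaplacian q m u x = 0 := by
    intro m x hx hx0
    refine abs_nonpos_iff.1 (le_of_forall_pos_le_add fun ε hε => ?_)
    obtain ⟨N, hN⟩ := hu ε hε
    -- Descending `N` levels costs `5^N`, which leaves `2/3 ε / 5^m`, at most `ε` whatever `N` is.
    have := hdesc N m (2 / 3 * ε / 5 ^ (m + N)) (fun x hx hx0 => by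
      have h := hN (m + N) (by omega) x hx hx0
      rw [ContinuousMap.zero_apply, sub_zero, abs_mul, abs_of_pos (by positivity)] at h
      rw [le_div_iff₀ (by positivity)]
      linarith) x hx hx0
    refine this.trans ?_
    rw [zero_add, ← mul_div_assoc, div_le_iff₀ (by positivity), pow_add]
    have h1 : (1 : ℝ) ≤ 5 ^ m := one_le_pow₀ (by norm_num)
    have h2 : (0 : ℝ) < 5 ^ N := by positivity
    have h3 := mul_le_mul_of_nonneg_left h1 (by positivity : (0 : ℝ) ≤ ε * 5 ^ N)
    have h4 : (0 : ℝ) < ε * 5 ^ N := by positivity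
    linarith
  -- The three equations at the midpoints form an invertible linear system whose solution is the
  -- extension rule.
  have hrule : ∀ v : SG q → ℝ,
      (∀ i j, i ≠ j → graphLaplacian q 1 v (F q i (bdry q j)) = 0) →
      ∀ i j, v (F q i (bdry q j)) = rule i (fun k => v (bdry q k)) j := by
    intro v h i j
    have k01 := h 0 1 (by decide)
    have k02 := h 0 2 (by decide)
    have k12 := h 1 2 (by decide)
    rw [graphLaplacian_succ_junction hq 0 v (by decide), graphLaplacian_zero_bdry hq,
      graphLaplacian_zero_bdry hq] at k01 k02 k12
    simp only [Function.comp_apply, Fin.sum_univ_three, F_bdry_self,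
      F_bdry_comm (q := q) 1 0, F_bdry_comm (q := q) 2 0, F_bdry_comm (q := q) 2 1] at k01 k02 k12
    simp only [rule, Fin.sum_univ_three]
    fin_cases i <;> fin_cases j <;> simp [F_bdry_self,
      F_bdry_comm (q := q) 1 0, F_bdry_comm (q := q) 2 0, F_bdry_comm (q := q) 2 1] <;> linarith
  have hcomp : ∀ (w : List (Fin 3)) (m : ℕ) (v : SG q → ℝ) (x : SG q), x ∉ V q 0 →
      graphLaplacian q (m + w.length) v (wordMap q w x) = graphLaplacian q m (v ∘ wordMap q w) x := by
    intro w
    induction w with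
    | nil => intro m v x _; rfl
    | cons i w ih =>
      intro m v x hx
      rw [List.length_cons, ← add_assoc, wordMap_cons, graphLaplacian_succ_interior hq _ _ _
        (wordMap_not_mem_V_zero hq w hx), ih m _ x hx]
      rfl
  intro w
  refine hrule (u ∘ wordMap q w) fun i j hij => ?_
  have hx0 : F q i (bdry q j) ∉ V q 0 := F_bdry_not_mem_V_zero hq hij
  rw [← hcomp w 1 u _ hx0]
  exact hzero _ _ (wordMap_mem_V w ((F_mem_V_succ hq).2 (bdry_mem_V 0 j)))
    (wordMap_not_mem_V_zero hq w hx0)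

end Harmonic

section Tent

variable {q : Fin 3 → Plane}

/-! ### Piecewise harmonic functions and tents -/

/-- Harmonic on each cell of level `m`. -/
def IsSpline (q : Fin 3 → Plane) (m : ℕ) (u : SG q → ℝ) : Prop :=
  ∀ w : List (Fin 3), w.length = m → IsHarm q (u ∘ wordMap q w)

theorem IsSpline.comp_F {m : ℕ} {u : SG q → ℝ} (hu : IsSpline q (m + 1) u) (i : Fin 3) :
    IsSpline q m (u ∘ F q i) := fun w hw => hu (i :: w) (by simp [hw])

theorem IsSpline.ext {m : ℕ} {u v : C(SG q, ℝ)} (hu : IsSpline q m u) (hv : IsSpline q m v)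
    (h : ∀ x ∈ V q m, u x = v x) : u = v := by
  induction m generalizing u v with
  | zero => exact IsHarm.ext (hu [] rfl) (hv [] rfl) fun k => h _ (bdry_mem_V_zero k)
  | succ m ih =>
    ext x
    obtain ⟨i, y, rfl⟩ := F_surjective x
    have := ih (u := u.comp (F q i)) (v := v.comp (F q i)) (hu.comp_F i) (hv.comp_F i)
      fun x hx => h _ (mem_V_succ.2 ⟨i, x, hx, rfl⟩)
    exact DFunLike.congr_fun this y

theorem exists_isSpline (hq : Equilateral q) (m : ℕ) (a : SG q → ℝ) :
    ∃ u : C(SG q, ℝ), IsSpline q m u ∧ ∀ x ∈ V q m, u x = a x := by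
  induction m generalizing a with
  | zero =>
    refine ⟨harm hq fun k => a (bdry q k), fun w hw => ?_, fun x hx => ?_⟩
    · rw [List.length_eq_zero_iff.1 hw]; exact isHarm_harm hq _
    · obtain ⟨k, rfl⟩ := mem_V_zero.1 hx; exact harm_bdry hq _ k
  | succ m ih =>
    choose u hu hua using fun i => ih (a ∘ F q i)
    obtain ⟨v, hv⟩ := exists_glue hq u fun i j => by
      rw [hua i _ (bdry_mem_V m j), hua j _ (bdry_mem_V m i), Function.comp_apply,
        Function.comp_apply, F_bdry_comm]
    refine ⟨v, fun w hw => ?_, fun x hx => ?_⟩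
    · obtain _ | ⟨i, w⟩ := w
      · simp at hw
      · have : v ∘ wordMap q (i :: w) = u i ∘ wordMap q w := funext fun x => hv i _
        rw [this]
        exact hu i w (by simpa using hw)
    · obtain ⟨i, y, hy, rfl⟩ := mem_V_succ.1 hx
      rw [hv, hua i y hy]; rfl

-- The condition in the definition of `tent` is satisfiable by a piecewise harmonic interpolant, so
-- the choice is meaningful; vanishing of the Laplacian in each cell is then converted to the
-- extension rule.
open scoped Classical in
theorem tent_spec (hq : Equilateral q) (m : ℕ) (z : SG q) :
    IsSpline q m (tent q m z) ∧ ∀ x ∈ V q m, tent q m z x = if x = z then 1 else 0 := by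
  have hex : ∃ u : C(SG q, ℝ),
      (∀ w : List (Fin 3), w.length = m → HasLaplacian q (u.comp (wordMap q w)) 0) ∧
      ∀ x ∈ V q m, u x = if x = z then 1 else 0 := by
    obtain ⟨u, hu, hua⟩ := exists_isSpline hq m fun x => if x = z then 1 else 0
    exact ⟨u, fun w hw => IsHarm.hasLaplacian_zero hq (u := u.comp (wordMap q w)) (hu w hw), hua⟩
  obtain ⟨h1, h2⟩ := Classical.epsilon_spec hex
  exact ⟨fun w hw => (h1 w hw).isHarm hq, h2⟩

theorem tent_apply_self (hq : Equilateral q) {m : ℕ} {z : SG q} (hz : z ∈ V q m) :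
    tent q m z z = 1 := by rw [(tent_spec hq m z).2 z hz, if_pos rfl]

theorem tent_apply_of_ne (hq : Equilateral q) {m : ℕ} {z x : SG q} (hx : x ∈ V q m)
    (h : x ≠ z) : tent q m z x = 0 := by rw [(tent_spec hq m z).2 x hx, if_neg h]

/-- Piecewise harmonic functions are determined by their vertex values, and an interior vertex of
one cell lies in no other cell. -/
theorem tent_F_comp_F (hq : Equilateral q) (m : ℕ) {z : SG q} (hz : z ∉ V q 0) (i j : Fin 3) :
    (tent q (m + 1) (F q i z)).comp (F q j) = if i = j then tent q m z else 0 := by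
  have hs : IsSpline q m ((tent q (m + 1) (F q i z)).comp (F q j)) :=
    (tent_spec hq (m + 1) (F q i z)).1.comp_F j
  split_ifs with hij
  · subst hij
    refine hs.ext (tent_spec hq m z).1 fun x hx => ?_
    rw [ContinuousMap.comp_apply]
    by_cases hxz : x = z
    · subst hxz
      rw [tent_apply_self hq hx, tent_apply_self hq ((F_mem_V_succ hq).2 hx)]
    · rw [tent_apply_of_ne hq hx hxz,
        tent_apply_of_ne hq ((F_mem_V_succ hq).2 hx) ((F_injective hq i).ne hxz)]
  · refine hs.ext (v := 0) (fun w _ => IsHarm.zero) fun x hx => ?_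
    rw [ContinuousMap.comp_apply, ContinuousMap.zero_apply]
    exact tent_apply_of_ne hq ((F_mem_V_succ hq).2 hx)
      fun h => hij ((F_eq_F_iff hq hz).1 h.symm).1

/-! ### Green's function -/

open scoped Classical in
/-- The vertices that are new at level `m + 1`. -/
noncomputable def newV (q : Fin 3 → Plane) (m : ℕ) : Finset (SG q) := V q (m + 1) \ V q m

theorem mem_newV {m : ℕ} {z : SG q} : z ∈ newV q m ↔ z ∈ V q (m + 1) ∧ z ∉ V q m := by
  simp [newV]

theorem not_mem_V_zero_of_mem_newV {m : ℕ} {z : SG q} (hz : z ∈ newV q m) : z ∉ V q 0 :=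
  fun h => (mem_newV.1 hz).2 (V_zero_subset m h)

/-- New vertices are never boundary points, so their images in different cells are disjoint and no
junction is counted twice. -/
theorem sum_newV_succ (hq : Equilateral q) (m : ℕ) (g : SG q → ℝ) :
    ∑ z ∈ newV q (m + 1), g z = ∑ i, ∑ z ∈ newV q m, g (F q i z) := by
  classical
  have h : newV q (m + 1) = Finset.univ.biUnion fun i => (newV q m).image (F q i) := by
    ext z
    simp only [mem_newV, Finset.mem_biUnion, Finset.mem_univ, true_and, Finset.mem_image]
    constructor
    · rintro ⟨h1, h2⟩
      obtain ⟨i, y, hy, rfl⟩ := mem_V_succ.1 h1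
      exact ⟨i, y, ⟨hy, fun h => h2 ((F_mem_V_succ hq).2 h)⟩, rfl⟩
    · rintro ⟨i, y, ⟨h1, h2⟩, rfl⟩
      exact ⟨(F_mem_V_succ hq).2 h1, fun h => h2 ((F_mem_V_succ hq).1 h)⟩
  rw [h, Finset.sum_biUnion]
  · exact Finset.sum_congr rfl fun i _ => sum_image_F hq i _ _
  · intro i _ j _ hij
    rw [Function.onFun, Finset.disjoint_left]
    intro z hz hz'
    obtain ⟨a, ha, rfl⟩ := Finset.mem_image.1 hz
    obtain ⟨b, hb, hab⟩ := Finset.mem_image.1 hz'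
    exact hij ((F_eq_F_iff hq (not_mem_V_zero_of_mem_newV ha)).1 hab.symm).1

/-- The contribution of level `m` to Green's function. -/
noncomputable def greenTerm (q : Fin 3 → Plane) (m : ℕ) (x y : SG q) : ℝ :=
  ∑ z ∈ newV q m, ∑ z' ∈ newV q m,
    greenCoeff q m z z' * tent q (m + 1) z x * tent q (m + 1) z' y

theorem greenCoeff_comm (m : ℕ) (z z' : SG q) : greenCoeff q m z z' = greenCoeff q m z' z := by
  unfold greenCoeff
  classical
  exact if_congr eq_comm rfl (if_congr sameCell_comm rfl rfl)

theorem greenTerm_comm (m : ℕ) (x y : SG q) : greenTerm q m x y = greenTerm q m y x := by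
  unfold greenTerm
  rw [Finset.sum_comm]
  refine Finset.sum_congr rfl fun z _ => Finset.sum_congr rfl fun z' _ => ?_
  rw [greenCoeff_comm]; ring

theorem greenTerm_bdry (hq : Equilateral q) (m : ℕ) (k : Fin 3) (y : SG q) :
    greenTerm q m (bdry q k) y = 0 := by
  refine Finset.sum_eq_zero fun z hz => Finset.sum_eq_zero fun z' _ => ?_
  rw [tent_apply_of_ne hq (bdry_mem_V (m + 1) k)
    (not_mem_V_zero (not_mem_V_zero_of_mem_newV hz) k).symm]
  ring

theorem greenCoeff_F (hq : Equilateral q) (m : ℕ) {z z' : SG q} (hz : z ∉ V q 0)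
    (hz' : z' ∉ V q 0) (i j : Fin 3) : greenCoeff q (m + 1) (F q i z) (F q j z')
      = if i = j then 3 / 5 * greenCoeff q m z z' else 0 := by
  have h1 : F q i z = F q j z' ↔ i = j ∧ z = z' := F_eq_F_iff hq hz
  have h2 : SameCell q (m + 1 + 1) (F q i z) (F q j z') ↔ i = j ∧ SameCell q (m + 1) z z' := by
    rw [sameCell_succ]
    constructor
    · rintro ⟨k, x, y, h, hx, hy⟩
      obtain ⟨rfl, rfl⟩ := (F_eq_F_iff hq hz).1 hx.symm
      obtain ⟨rfl, rfl⟩ := (F_eq_F_iff hq hz').1 hy.symm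
      exact ⟨rfl, h⟩
    · rintro ⟨rfl, h⟩
      exact ⟨i, z, z', h, rfl, rfl⟩
  classical
  have h3 : greenCoeff q (m + 1) (F q i z) (F q j z') = if i = j ∧ z = z' then
      9 / 50 * (3 / 5) ^ (m + 1) else if i = j ∧ SameCell q (m + 1) z z' then
      3 / 50 * (3 / 5) ^ (m + 1) else 0 := if_congr h1 rfl (if_congr h2 rfl rfl)
  have h4 : greenCoeff q m z z' = if z = z' then
      9 / 50 * (3 / 5) ^ m else if SameCell q (m + 1) z z' then
      3 / 50 * (3 / 5) ^ m else 0 := if_congr Iff.rfl rfl (if_congr Iff.rfl rfl rfl)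
  rw [h3, h4]
  by_cases hij : i = j
  · simp only [hij, true_and, if_true]
    split_ifs <;> ring
  · simp [hij]

/-- Both the coefficients and the tents at level `m + 1` are block diagonal over the three cells.
Each block is the previous level, with `3/5` coming from the coefficients. -/
theorem greenTerm_F (hq : Equilateral q) (m : ℕ) (i j : Fin 3) (x y : SG q) :
    greenTerm q (m + 1) (F q i x) (F q j y) = if i = j then 3 / 5 * greenTerm q m x y else 0 := by
  have ht : ∀ k l, ∀ z ∈ newV q m, ∀ x, tent q (m + 1 + 1) (F q k z) (F q l x)
      = if k = l then tent q (m + 1) z x else 0 := by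
    intro k l z hz x
    have := DFunLike.congr_fun (tent_F_comp_F hq (m + 1) (not_mem_V_zero_of_mem_newV hz) k l) x
    rw [ContinuousMap.comp_apply] at this
    rw [this]
    split_ifs <;> rfl
  unfold greenTerm
  have key : ∀ k, ∀ z ∈ newV q m, ∑ z' ∈ newV q (m + 1), greenCoeff q (m + 1) (F q k z) z' *
      tent q (m + 1 + 1) (F q k z) (F q i x) * tent q (m + 1 + 1) z' (F q j y)
      = if k = i then if i = j then 3 / 5 * ∑ z' ∈ newV q m,
        greenCoeff q m z z' * tent q (m + 1) z x * tent q (m + 1) z' y else 0 else 0 := by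
    intro k z hz
    rw [sum_newV_succ hq, Finset.sum_eq_single j]
    · by_cases hki : k = i
      · subst hki
        rw [if_pos rfl]
        by_cases hkj : k = j
        · subst hkj
          rw [if_pos rfl, Finset.mul_sum]
          refine Finset.sum_congr rfl fun z' hz' => ?_
          rw [greenCoeff_F hq m (not_mem_V_zero_of_mem_newV hz) (not_mem_V_zero_of_mem_newV hz'),
            ht k k z hz, ht k k z' hz', if_pos rfl, if_pos rfl, if_pos rfl]
          ring
        · rw [if_neg hkj]
          refine Finset.sum_eq_zero fun z' hz' => ?_
          rw [greenCoeff_F hq m (not_mem_V_zero_of_mem_newV hz) (not_mem_V_zero_of_mem_newV hz'),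
            if_neg hkj]
          ring
      · rw [if_neg hki]
        refine Finset.sum_eq_zero fun z' hz' => ?_
        rw [ht k i z hz, if_neg hki]
        ring
    · intro l _ hlj
      refine Finset.sum_eq_zero fun z' hz' => ?_
      rw [ht l j z' hz', if_neg hlj]
      ring
    · simp
  rw [sum_newV_succ hq, Finset.sum_eq_single i]
  · rw [Finset.sum_congr rfl (key i)]
    simp only [if_true]
    split_ifs
    · rw [Finset.mul_sum]
    · simp
  · intro k _ hki
    rw [Finset.sum_congr rfl (key k)]
    simp [hki]
  · simp

theorem continuous_greenTerm (m : ℕ) :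
    Continuous fun z : SG q × SG q => greenTerm q m z.1 z.2 := by
  unfold greenTerm
  fun_prop

/-- The bound on level zero is compactness; self-similarity gives the factor `3/5` per level. It
makes the series for Green's function uniformly convergent. -/
theorem exists_greenTerm_bound (hq : Equilateral q) :
    ∃ C : ℝ, ∀ m x y, |greenTerm q m x y| ≤ C * (3 / 5) ^ m := by
  obtain ⟨C, hC⟩ := isCompact_univ.exists_bound_of_continuousOn
    (continuous_greenTerm (q := q) 0).continuousOn
  have h0 : 0 ≤ C := (norm_nonneg _).trans (hC (bdry q 0, bdry q 0) (Set.mem_univ _))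
  refine ⟨C, fun m => ?_⟩
  induction m with
  | zero => intro x y; simpa using hC (x, y) (Set.mem_univ _)
  | succ m ih =>
    intro x y
    obtain ⟨i, x, rfl⟩ := F_surjective x
    obtain ⟨j, y, rfl⟩ := F_surjective y
    rw [greenTerm_F hq]
    split_ifs
    · rw [abs_mul, abs_of_pos (by norm_num : (0 : ℝ) < 3 / 5), pow_succ]
      linarith [ih x y]
    · rw [abs_zero]; positivity

theorem hasSum_green (hq : Equilateral q) (x y : SG q) :
    HasSum (fun m => greenTerm q m x y) (green q x y) := by
  obtain ⟨C, hC⟩ := exists_greenTerm_bound hq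
  have hs : Summable fun m => greenTerm q m x y :=
    Summable.of_norm_bounded ((summable_geometric_of_lt_one (by norm_num)
      (by norm_num : (3 / 5 : ℝ) < 1)).mul_left C) fun m => hC m x y
  have ht : Tendsto (fun M => greenPartial q M x y) atTop (𝓝 (∑' m, greenTerm q m x y)) :=
    hs.hasSum.tendsto_sum_nat.comp (tendsto_add_atTop_nat 1)
  rw [green, ht.limUnder_eq]
  exact hs.hasSum

theorem continuous_green (hq : Equilateral q) :
    Continuous fun z : SG q × SG q => green q z.1 z.2 := by
  obtain ⟨C, hC⟩ := exists_greenTerm_bound hq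
  have : (fun z : SG q × SG q => green q z.1 z.2) = fun z => ∑' m, greenTerm q m z.1 z.2 :=
    funext fun z => (hasSum_green hq z.1 z.2).tsum_eq.symm
  rw [this]
  exact continuous_tsum continuous_greenTerm ((summable_geometric_of_lt_one (by norm_num)
      (by norm_num : (3 / 5 : ℝ) < 1)).mul_left C) fun m z => hC m z.1 z.2

theorem green_comm (hq : Equilateral q) (x y : SG q) : green q x y = green q y x :=
  (hasSum_green hq x y).unique (by simpa only [greenTerm_comm _ x y] using hasSum_green hq y x)

theorem green_bdry (hq : Equilateral q) (k : Fin 3) (y : SG q) : green q (bdry q k) y = 0 :=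
  (hasSum_green hq _ y).unique (by simpa only [greenTerm_bdry hq] using hasSum_zero)

/-- The self-similarity of Green's function. -/
theorem green_F (hq : Equilateral q) (i j : Fin 3) (x y : SG q) :
    green q (F q i x) (F q j y) = greenTerm q 0 (F q i x) (F q j y)
      + if i = j then 3 / 5 * green q x y else 0 := by
  have h := hasSum_green hq (F q i x) (F q j y)
  rw [← h.tsum_eq, h.summable.tsum_eq_zero_add]
  congr 1
  simp only [greenTerm_F hq]
  split_ifs
  · exact ((hasSum_green hq x y).mul_left (3 / 5)).tsum_eq
  · exact tsum_zero

/-! ### Level one -/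

/-- The midpoint of the side opposite to the vertex `k`. -/
noncomputable def mid (q : Fin 3 → Plane) (k : Fin 3) : SG q := F q (k + 1) (bdry q (k + 2))

theorem F_bdry_eq_mid_iff (hq : Equilateral q) (i j k : Fin 3) :
    F q i (bdry q j) = mid q k ↔ i ≠ k ∧ j ≠ k ∧ i ≠ j := by
  constructor
  · intro h
    have hc := fun l => congrArg (coord q l) h
    simp only [mid, coord_F hq, coord_bdry hq] at hc
    have h0 := hc 0
    have h1 := hc 1
    have h2 := hc 2
    fin_cases i <;> fin_cases j <;> fin_cases k <;> simp at h0 h1 h2 ⊢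
  · intro h
    fin_cases i <;> fin_cases j <;> fin_cases k <;> simp at h <;>
      first | rfl | exact F_bdry_comm _ _

theorem F_bdry_eq_mid (hq : Equilateral q) {i j k : Fin 3} (hik : i ≠ k) (hjk : j ≠ k)
    (hij : i ≠ j) : F q i (bdry q j) = mid q k := (F_bdry_eq_mid_iff hq i j k).2 ⟨hik, hjk, hij⟩

theorem mid_injective (hq : Equilateral q) : Function.Injective (mid q) := by
  intro k l h
  have h1 := (F_bdry_eq_mid_iff hq (k + 1) (k + 2) l).1 h
  have h2 : ∀ k l : Fin 3, k + 1 ≠ l ∧ k + 2 ≠ l ∧ k + 1 ≠ k + 2 → k = l := by decide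
  exact h2 k l h1

theorem mid_mem_V (k : Fin 3) : mid q k ∈ V q 1 := mem_V_succ.2 ⟨_, _, bdry_mem_V 0 _, rfl⟩

theorem sum_newV_zero (hq : Equilateral q) (g : SG q → ℝ) :
    ∑ z ∈ newV q 0, g z = ∑ k, g (mid q k) := by
  classical
  have h : newV q 0 = Finset.univ.image (mid q) := by
    ext z
    simp only [mem_newV, Finset.mem_image, Finset.mem_univ, true_and]
    constructor
    · rintro ⟨h1, h2⟩
      obtain ⟨i, y, h, h', -⟩ | ⟨i, j, hij, rfl⟩ := V_succ_cases h1 h2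
      · exact absurd h h'
      · have h3 : ∀ i j : Fin 3, ∃ k, i ≠ k ∧ j ≠ k := by decide
        obtain ⟨k, h1, h2⟩ := h3 i j
        exact ⟨k, (F_bdry_eq_mid hq h1 h2 hij).symm⟩
    · rintro ⟨k, rfl⟩
      exact ⟨mid_mem_V k, F_bdry_not_mem_V_zero hq (by revert k; decide)⟩
  rw [h, Finset.sum_image fun _ _ _ _ h => mid_injective hq h]

/-- The tent of level one at the midpoint opposite to the vertex `k`. -/
noncomputable def tentOne (q : Fin 3 → Plane) (k : Fin 3) : C(SG q, ℝ) := tent q 1 (mid q k)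

theorem tentOne_F_bdry (hq : Equilateral q) (i j k : Fin 3) :
    tentOne q k (F q i (bdry q j)) = if i ≠ k ∧ j ≠ k ∧ i ≠ j then 1 else 0 := by
  classical
  rw [tentOne, (tent_spec hq 1 _).2 _ ((F_mem_V_succ hq).2 (bdry_mem_V 0 j))]
  simp only [F_bdry_eq_mid_iff hq]

theorem tentOne_isHarm_F (hq : Equilateral q) (k i : Fin 3) : IsHarm q (tentOne q k ∘ F q i) :=
  (tent_spec hq 1 (mid q k)).1 [i] rfl

/-- Any two midpoints share a cell, so no coefficient vanishes. The matrix with entries `9/50` and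
`3/50` is `3/5` times the inverse of the level-one Dirichlet matrix with diagonal 4 and off-diagonal
entries -1. -/
theorem greenTerm_zero (hq : Equilateral q) (x y : SG q) : greenTerm q 0 x y
    = ∑ k, ∑ l, (if k = l then 9 / 50 else 3 / 50) * tentOne q k x * tentOne q l y := by
  unfold greenTerm
  simp only [sum_newV_zero hq]
  refine Finset.sum_congr rfl fun k _ => Finset.sum_congr rfl fun l _ => ?_
  have hc : greenCoeff q 0 (mid q k) (mid q l) = if k = l then 9 / 50 else 3 / 50 := by
    unfold greenCoeff
    simp only [(mid_injective hq).eq_iff, pow_zero, mul_one]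
    by_cases hkl : k = l
    · rw [if_pos hkl, if_pos hkl]
    · obtain ⟨i, h1, h2⟩ : ∃ i, i ≠ k ∧ i ≠ l := by revert k l; decide
      rw [if_neg hkl, if_neg hkl, if_pos]
      exact sameCell_succ.2 ⟨i, bdry q l, bdry q k, sameCell_zero _ _,
        F_bdry_eq_mid hq h1 (Ne.symm hkl) h2, F_bdry_eq_mid hq h2 hkl h1⟩
  rw [hc]
  rfl

end Tent

/-! ### The self-similar measure -/

/-- Prefix a symbol to an infinite word. -/
def prefixed (i : Fin 3) (w : ℕ → Fin 3) : ℕ → Fin 3 := fun n => Nat.casesOn n i w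

theorem continuous_prefixed (i : Fin 3) : Continuous (prefixed i) := by
  refine continuous_pi fun n => ?_
  cases n with
  | zero => exact continuous_const
  | succ n => exact continuous_apply n

/-- The law of a sequence of independent, uniformly distributed symbols. -/
noncomputable abbrev wordMeasure : Measure (ℕ → Fin 3) :=
  Measure.infinitePi fun _ : ℕ => (PMF.uniformOfFintype (Fin 3)).toMeasure

theorem uniform_apply (s : Set (Fin 3)) : (PMF.uniformOfFintype (Fin 3)).toMeasure s
    = ((1 / 3 : NNReal) • ∑ i, s.indicator (1 : Fin 3 → ENNReal) i) := by
  classical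
  rw [PMF.toMeasure_apply_fintype, Finset.smul_sum]
  refine Finset.sum_congr rfl fun i _ => ?_
  by_cases hi : i ∈ s
  · simp [hi, ENNReal.smul_def]
  · simp [hi]

/-- An i.i.d. sequence keeps its law when an independent uniform symbol is put in front; it suffices
to check this on cylinders. -/
theorem wordMeasure_eq :
    wordMeasure = (1 / 3 : NNReal) • ∑ i, wordMeasure.map (prefixed i) := by
  classical
  symm
  refine Measure.eq_infinitePi _ fun s t ht => ?_
  -- Trivial conditions enlarge the index set to an initial segment, so that position 0 is present
  -- and the remaining positions can be shifted.
  set t' : ℕ → Set (Fin 3) := fun n => if n ∈ s then t n else Set.univ with ht'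
  have hm : ∀ n, MeasurableSet (t' n) := fun n => Set.Finite.measurableSet (Set.toFinite _)
  obtain ⟨N, hN⟩ : ∃ N, s ⊆ Finset.range (N + 1) := by
    obtain ⟨N, hN⟩ := s.exists_nat_subset_range
    exact ⟨N, hN.trans (Finset.range_mono (Nat.le_succ N))⟩
  have hset : Set.pi (s : Set ℕ) t = Set.pi (Finset.range (N + 1) : Set ℕ) t' := by
    ext w
    simp only [Set.mem_pi, ht']
    constructor
    · intro h n _
      by_cases hn : n ∈ s
      · rw [if_pos hn]; exact h n hn
      · rw [if_neg hn]; trivial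
    · intro h n hn
      have := h n (hN hn)
      rwa [if_pos (by exact hn)] at this
  have hprod : ∏ n ∈ s, (PMF.uniformOfFintype (Fin 3)).toMeasure (t n)
      = ∏ n ∈ Finset.range (N + 1), (PMF.uniformOfFintype (Fin 3)).toMeasure (t' n) := by
    rw [← Finset.prod_subset hN]
    · exact Finset.prod_congr rfl fun n hn => by simp [ht', hn]
    · intro n _ hn
      simp [ht', hn]
  rw [hset, hprod, Finset.prod_range_succ', mul_comm, uniform_apply]
  have hpi : MeasurableSet (Set.pi (Finset.range (N + 1) : Set ℕ) t') :=
    MeasurableSet.pi (Finset.countable_toSet _) fun n _ => hm n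
  have key : ∀ i, wordMeasure.map (prefixed i) (Set.pi (Finset.range (N + 1) : Set ℕ) t')
      = (t' 0).indicator (1 : Fin 3 → ENNReal) i
        * ∏ n ∈ Finset.range N, (PMF.uniformOfFintype (Fin 3)).toMeasure (t' (n + 1)) := by
    intro i
    rw [Measure.map_apply (continuous_prefixed i).measurable hpi]
    by_cases hi : i ∈ t' 0
    · have : prefixed i ⁻¹' Set.pi (Finset.range (N + 1) : Set ℕ) t'
          = Set.pi (Finset.range N : Set ℕ) fun n => t' (n + 1) := by
        ext w
        simp only [Set.mem_preimage, Set.mem_pi, Finset.coe_range, Set.mem_Iio]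
        constructor
        · intro h n hn; exact h (n + 1) (by omega)
        · intro h n hn
          cases n with
          | zero => exact hi
          | succ n => exact h n (by omega)
      rw [this, Measure.infinitePi_pi _ fun n _ => hm (n + 1)]
      simp [hi]
    · have : prefixed i ⁻¹' Set.pi (Finset.range (N + 1) : Set ℕ) t' = ∅ := by
        ext w
        simp only [Set.mem_preimage, Set.mem_pi, Finset.coe_range, Set.mem_Iio,
          Set.mem_empty_iff_false, iff_false]
        intro h
        exact hi (h 0 (by omega))
      rw [this, measure_empty, Set.indicator_of_notMem hi, zero_mul]
  rw [Measure.smul_apply, Measure.finsetSum_apply]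
  simp only [key]
  rw [← Finset.sum_mul, smul_mul_assoc]

/-! ### Integration over the gasket. -/

section Measure

variable {q : Fin 3 → Plane}

/-- The point of the gasket with a given address. -/
noncomputable def point (q : Fin 3 → Plane) : (ℕ → Fin 3) → SG q := Set.rangeFactorization (address q)

theorem continuous_point : Continuous (point q) :=
  (continuous_address q).subtype_mk _

theorem point_prefixed (i : Fin 3) (w : ℕ → Fin 3) :
    point q (prefixed i w) = F q i (point q w) :=
  Subtype.ext (contraction_address q i w).symm

theorem mu_eq : mu q = wordMeasure.map (point q) := rfl

instance : IsProbabilityMeasure (mu q) :=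
  Measure.isProbabilityMeasure_map continuous_point.measurable.aemeasurable

theorem integrable_mu (f : C(SG q, ℝ)) : Integrable f (mu q) :=
  f.continuous.integrable_of_hasCompactSupport (HasCompactSupport.of_compactSpace f)

/-- Self-similarity of the measure. -/
theorem integral_mu_eq (f : C(SG q, ℝ)) :
    ∫ x, f x ∂(mu q) = 1 / 3 * ∑ i, ∫ x, f (F q i x) ∂(mu q) := by
  have hint : ∀ i, ∫ x, f (F q i x) ∂(mu q)
      = ∫ w, f (point q w) ∂(wordMeasure.map (prefixed i)) := by
    intro i
    rw [mu_eq, integral_map continuous_point.measurable.aemeasurable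
      (f := fun x => f (F q i x)) (f.comp (F q i)).continuous.aestronglyMeasurable,
      integral_map (continuous_prefixed i).measurable.aemeasurable
      (f := fun w => f (point q w))
      (f.continuous.comp continuous_point).aestronglyMeasurable]
    simp only [point_prefixed]
  have hi : ∀ i : Fin 3, Integrable (fun w => f (point q w)) (wordMeasure.map (prefixed i)) := by
    intro i
    have : IsProbabilityMeasure (wordMeasure.map (prefixed i)) :=
      Measure.isProbabilityMeasure_map (continuous_prefixed i).measurable.aemeasurable
    exact (f.continuous.comp continuous_point).integrable_of_hasCompactSupport
      (HasCompactSupport.of_compactSpace _)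
  simp only [hint]
  rw [mu_eq, integral_map continuous_point.measurable.aemeasurable
      f.continuous.aestronglyMeasurable]
  conv_lhs => rw [wordMeasure_eq]
  rw [integral_smul_nnreal_measure, integral_finsetSum_measure fun i _ => hi i, NNReal.smul_def]
  simp

/-- By self-similarity a vanishing integral of a nonnegative function vanishes over every cell,
whereas near a point with `f x > 0` some cell has `f ≥ f x / 2`. This makes `ip` definite on
continuous functions. -/
theorem eq_zero_of_integral_eq_zero {f : C(SG q, ℝ)} (h0 : ∀ x, 0 ≤ f x)
    (h : ∫ x, f x ∂(mu q) = 0) : f = 0 := by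
  have hcell : ∀ w : List (Fin 3), ∫ x, f (wordMap q w x) ∂(mu q) = 0 := by
    intro w
    induction w generalizing f with
    | nil => exact h
    | cons i w ih =>
      refine ih (f := f.comp (F q i)) (fun x => h0 _) ?_
      rw [integral_mu_eq] at h
      have hs : ∑ i, ∫ x, f (F q i x) ∂(mu q) = 0 := by linarith
      exact (Finset.sum_eq_zero_iff_of_nonneg
        fun i _ => integral_nonneg fun x => h0 _).1 hs i (Finset.mem_univ i)
  ext x
  by_contra hne
  have hpos : 0 < f x := lt_of_le_of_ne (h0 x) (Ne.symm hne)
  obtain ⟨N, hN⟩ := exists_cell_osc_lt f (half_pos hpos)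
  obtain ⟨w, hw, y, rfl⟩ := exists_wordMap_eq N x
  have hle : ∫ _, f (wordMap q w y) / 2 ∂(mu q) ≤ ∫ x, f (wordMap q w x) ∂(mu q) := by
    refine integral_mono (integrable_const _)
      (integrable_mu (f.comp (wordMap q w))) fun z => ?_
    have := abs_lt.1 (hN w hw.ge y z)
    change f (wordMap q w y) / 2 ≤ f (wordMap q w z)
    linarith
  rw [hcell, integral_const] at hle
  simp at hle
  linarith

/-! ### The inner product -/

theorem ip_comm (u v : SG q → ℝ) : ip q u v = ip q v u := by
  unfold ip
  simp only [mul_comm]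

theorem ip_add_left (u v w : C(SG q, ℝ)) :
    ip q (u + v : C(SG q, ℝ)) w = ip q u w + ip q v w := by
  refine Eq.trans ?_ (integral_add (integrable_mu (u * w))
    (integrable_mu (v * w)))
  simp [ip, add_mul]

theorem ip_smul_left (a : ℝ) (u w : C(SG q, ℝ)) :
    ip q (a • u : C(SG q, ℝ)) w = a * ip q u w := by
  unfold ip
  rw [← integral_const_mul]
  simp [mul_assoc]

theorem ip_sub_left (u v w : C(SG q, ℝ)) :
    ip q (u - v : C(SG q, ℝ)) w = ip q u w - ip q v w := by
  have := ip_add_left u ((-1 : ℝ) • v) w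
  rw [ip_smul_left] at this
  have e : u + (-1 : ℝ) • v = u - v := by module
  rw [e] at this
  linarith

theorem ip_sum_left {ι : Type*} (s : Finset ι) (u : ι → C(SG q, ℝ)) (w : C(SG q, ℝ)) :
    ip q (∑ i ∈ s, u i : C(SG q, ℝ)) w = ∑ i ∈ s, ip q (u i) w := by
  classical
  induction s using Finset.induction_on with
  | empty => simp [ip]
  | insert a s ha ih => rw [Finset.sum_insert ha, Finset.sum_insert ha, ip_add_left, ih]

theorem eq_zero_of_ip_self {u : C(SG q, ℝ)} (h : ip q u u = 0) : u = 0 := by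
  have := eq_zero_of_integral_eq_zero (f := u * u) (fun x => mul_self_nonneg _) h
  ext x
  have hx := DFunLike.congr_fun this x
  exact mul_self_eq_zero.1 hx

end Measure

section GreenOperator

variable {q : Fin 3 → Plane}

/-! ### Moments against harmonic functions -/

/-- The integral of `f` against the harmonic function with boundary values `δ_{jk}`. -/
noncomputable def moment (hq : Equilateral q) (f : C(SG q, ℝ)) (j : Fin 3) : ℝ :=
  ip q f (harm hq (Pi.single j 1))

theorem ip_eq_sum_cells (f u : C(SG q, ℝ)) :
    ip q f u = 1 / 3 * ∑ i, ip q (f.comp (F q i)) (u.comp (F q i)) :=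
  integral_mu_eq (f * u)

theorem ip_harmonic (hq : Equilateral q) (f : C(SG q, ℝ)) {u : C(SG q, ℝ)} (hu : IsHarm q u) :
    ip q f u = ∑ j, u (bdry q j) * moment hq f j := by
  have h : u = ∑ j, u (bdry q j) • harm hq (Pi.single j 1) := by
    refine hu.ext ?_ fun k => ?_
    · rw [ContinuousMap.coe_sum]
      exact IsHarm.sum _ fun j _ => (isHarm_harm hq _).smul _
    · rw [ContinuousMap.sum_apply]
      simp [harm_bdry, Pi.single_apply]
  conv_lhs => rw [ip_comm, h]
  rw [ip_sum_left]
  refine Finset.sum_congr rfl fun j _ => ?_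
  rw [ip_smul_left, ip_comm, moment]

theorem moment_eq (hq : Equilateral q) (f : C(SG q, ℝ)) (j : Fin 3) : moment hq f j
    = 1 / 3 * ∑ i, ∑ k, rule i (Pi.single j 1) k * moment hq (f.comp (F q i)) k := by
  rw [moment, ip_eq_sum_cells]
  congr 1
  refine Finset.sum_congr rfl fun i _ => ?_
  rw [harm_comp_F, ip_harmonic hq _ (isHarm_harm hq _)]
  simp only [harm_bdry]

/-- The recursion `moment_eq` becomes a linear system for the three moments of 1; total mass one
fixes its solution. -/
theorem moment_one (hq : Equilateral q) (j : Fin 3) : moment hq 1 j = 1 / 3 := by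
  have hc : ∀ i, (1 : C(SG q, ℝ)).comp (F q i) = 1 := fun i => rfl
  have h := moment_eq hq (1 : C(SG q, ℝ))
  have h1 : ip q (1 : C(SG q, ℝ)) (1 : C(SG q, ℝ)) = 1 := by simp [ip]
  rw [ip_harmonic hq _ (isHarm_const 1 : IsHarm q (1 : C(SG q, ℝ)))] at h1
  have h0 := h 0
  have h2 := h 1
  have h3 := h 2
  simp only [hc, rule, Fin.sum_univ_three, ContinuousMap.one_apply, Pi.single_apply]
    at h0 h1 h2 h3
  simp at h0 h1 h2 h3
  fin_cases j <;> simp <;> linarith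

/-- The harmonic weight is nonnegative with integral `1/3`. -/
theorem abs_moment_sub_le (hq : Equilateral q) (f : C(SG q, ℝ)) (j : Fin 3) {c ε : ℝ}
    (h : ∀ x, |f x - c| ≤ ε) : |moment hq f j - c / 3| ≤ ε / 3 := by
  set u := harm hq (Pi.single j 1) with hu
  have hpos : ∀ x, 0 ≤ u x := fun x =>
    ((isHarm_harm hq (Pi.single j 1)).mem_Icc (l := 0) (r := 1) (fun k => by
      rw [harm_bdry, Pi.single_apply]; split_ifs <;> simp) x).1
  have h1 : ∫ x, u x ∂(mu q) = 1 / 3 := by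
    rw [← moment_one hq j]; simp [moment, ip, hu]
  have h2 : ∀ a : ℝ, ∫ x, a * u x ∂(mu q) = a / 3 := fun a => by
    rw [integral_const_mul, h1]; ring
  have hle : ∀ a b : C(SG q, ℝ), (∀ x, a x ≤ b x) → ∫ x, a x ∂(mu q) ≤ ∫ x, b x ∂(mu q) :=
    fun a b hab => integral_mono (integrable_mu a) (integrable_mu b) hab
  have e1 := hle (f * u) ((c + ε) • u) fun x =>
    mul_le_mul_of_nonneg_right (by linarith [(abs_le.1 (h x)).2]) (hpos x)
  have e2 := hle ((c - ε) • u) (f * u) fun x =>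
    mul_le_mul_of_nonneg_right (by linarith [(abs_le.1 (h x)).1]) (hpos x)
  simp only [ContinuousMap.smul_apply, smul_eq_mul, h2] at e1 e2
  change ∫ x, (f * u) x ∂(mu q) ≤ _ at e1
  have e3 : moment hq f j = ∫ x, (f * u) x ∂(mu q) := rfl
  rw [e3, abs_le]
  constructor <;> linarith

/-! ### The Green operator -/

/-- The Green operator. -/
noncomputable def greenOp (hq : Equilateral q) (f : C(SG q, ℝ)) : C(SG q, ℝ) where
  toFun x := ∫ y, green q x y * f y ∂(mu q)
  continuous_toFun := by
    have h : Continuous (Function.uncurry fun x y => green q x y * f y) :=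
      (continuous_green hq).mul (f.continuous.comp continuous_snd)
    simpa using continuous_parametric_integral_of_continuous (μ := mu q) h isCompact_univ

theorem greenOp_apply (hq : Equilateral q) (f : C(SG q, ℝ)) (x : SG q) :
    greenOp hq f x = ∫ y, green q x y * f y ∂(mu q) := rfl

theorem greenOp_bdry (hq : Equilateral q) (f : C(SG q, ℝ)) (k : Fin 3) :
    greenOp hq f (bdry q k) = 0 := by
  simp [greenOp_apply, green_bdry hq]

/-- The Green operator is symmetric. -/
theorem ip_greenOp (hq : Equilateral q) (f g : C(SG q, ℝ)) :
    ip q (greenOp hq f) g = ip q f (greenOp hq g) := by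
  have hc : Continuous fun z : SG q × SG q => green q z.1 z.2 * f z.2 * g z.1 :=
    ((continuous_green hq).mul (f.continuous.comp continuous_snd)).mul
      (g.continuous.comp continuous_fst)
  have hi : Integrable (Function.uncurry fun x y => green q x y * f y * g x)
      ((mu q).prod (mu q)) :=
    hc.integrable_of_hasCompactSupport (HasCompactSupport.of_compactSpace _)
  unfold ip
  simp only [greenOp_apply, ← integral_mul_const, ← integral_const_mul]
  rw [integral_integral_swap hi]
  refine integral_congr_ae (Eventually.of_forall fun y => ?_)
  refine integral_congr_ae (Eventually.of_forall fun x => ?_)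
  simp only
  rw [green_comm hq]
  ring

/-- The contribution of level zero to the Green operator. -/
noncomputable def greenOpZero (q : Fin 3 → Plane) (f : C(SG q, ℝ)) : C(SG q, ℝ) :=
  ∑ k, (∑ l, (if k = l then 9 / 50 else 3 / 50) * ip q f (tentOne q l)) • tentOne q k

theorem integral_greenTerm_zero (hq : Equilateral q) (f : C(SG q, ℝ)) (x : SG q) :
    ∫ y, greenTerm q 0 x y * f y ∂(mu q) = greenOpZero q f x := by
  simp only [greenTerm_zero hq, Finset.sum_mul, greenOpZero, ContinuousMap.sum_apply,
    ContinuousMap.smul_apply, smul_eq_mul]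
  have hi : ∀ k l : Fin 3, Integrable (fun y => (if k = l then (9 / 50 : ℝ) else 3 / 50)
      * tentOne q k x * tentOne q l y * f y) (mu q) := fun k l =>
    integrable_mu (((if k = l then (9 / 50 : ℝ) else 3 / 50) * tentOne q k x) • tentOne q l * f)
  rw [integral_finsetSum _ fun k _ => integrable_finsetSum _ fun l _ => hi k l]
  refine Finset.sum_congr rfl fun k _ => ?_
  rw [integral_finsetSum _ fun l _ => hi k l]
  refine Finset.sum_congr rfl fun l _ => ?_
  rw [ip, mul_right_comm, ← integral_const_mul]
  congr 1
  funext y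
  ring

theorem continuous_green_right (hq : Equilateral q) (x : SG q) : Continuous (green q x) :=
  Continuous.uncurry_left x (continuous_green hq : Continuous (Function.uncurry (green q)))

theorem continuous_greenTerm_right (m : ℕ) (x : SG q) : Continuous (greenTerm q m x) :=
  Continuous.uncurry_left x
    (continuous_greenTerm m : Continuous (Function.uncurry (greenTerm q m)))

/-- The function `y ↦ G(x, y)`. -/
noncomputable def greenSlice (hq : Equilateral q) (x : SG q) : C(SG q, ℝ) :=
  ⟨green q x, continuous_green_right hq x⟩

/-- The level zero part of the function `y ↦ G(x, y)`. -/
noncomputable def greenSliceZero (q : Fin 3 → Plane) (x : SG q) : C(SG q, ℝ) :=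
  ⟨greenTerm q 0 x, continuous_greenTerm_right 0 x⟩

theorem greenOp_eq_ip (hq : Equilateral q) (f : C(SG q, ℝ)) (x : SG q) :
    greenOp hq f x = ip q (greenSlice hq x) f := rfl

theorem greenSlice_F (hq : Equilateral q) (i j : Fin 3) (x : SG q) :
    (greenSlice hq (F q i x)).comp (F q j) = (greenSliceZero q (F q i x)).comp (F q j)
      + (if i = j then 3 / 5 else 0 : ℝ) • greenSlice hq x := by
  ext y
  refine (green_F hq i j x y).trans ?_
  rw [ContinuousMap.add_apply, ContinuousMap.smul_apply, smul_eq_mul, ite_mul, zero_mul]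
  rfl

/-- The self-similarity of the Green operator. -/
theorem greenOp_comp_F (hq : Equilateral q) (f : C(SG q, ℝ)) (i : Fin 3) :
    (greenOp hq f).comp (F q i)
      = (greenOpZero q f).comp (F q i) + (1 / 5 : ℝ) • greenOp hq (f.comp (F q i)) := by
  ext x
  have h0 : greenOpZero q f (F q i x) = ip q (greenSliceZero q (F q i x)) f :=
    (integral_greenTerm_zero hq f (F q i x)).symm
  rw [ContinuousMap.comp_apply, ContinuousMap.add_apply, ContinuousMap.smul_apply,
    ContinuousMap.comp_apply, h0, greenOp_eq_ip, greenOp_eq_ip, ip_eq_sum_cells,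
    ip_eq_sum_cells (greenSliceZero q (F q i x)) f]
  simp only [greenSlice_F, ip_add_left, ip_smul_left, Finset.sum_add_distrib, ite_mul, zero_mul,
    Finset.sum_ite_eq, Finset.mem_univ, if_true, smul_eq_mul]
  ring

theorem ip_tentOne (hq : Equilateral q) (f : C(SG q, ℝ)) (l : Fin 3) : ip q f (tentOne q l)
    = 1 / 3 * ∑ i, ∑ j, (if i ≠ l ∧ j ≠ l ∧ i ≠ j then 1 else 0)
      * moment hq (f.comp (F q i)) j := by
  rw [ip_eq_sum_cells]
  congr 1
  refine Finset.sum_congr rfl fun i _ => ?_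
  rw [ip_harmonic hq _ (u := (tentOne q l).comp (F q i)) (tentOne_isHarm_F hq l i)]
  simp only [ContinuousMap.comp_apply, tentOne_F_bdry hq]

theorem greenOpZero_F_bdry (hq : Equilateral q) (f : C(SG q, ℝ)) (i j : Fin 3) :
    greenOpZero q f (F q i (bdry q j))
      = ∑ k, (∑ l, (if k = l then 9 / 50 else 3 / 50) * ip q f (tentOne q l))
        * (if i ≠ k ∧ j ≠ k ∧ i ≠ j then 1 else 0) := by
  simp only [greenOpZero, ContinuousMap.sum_apply, ContinuousMap.smul_apply, smul_eq_mul,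
    tentOne_F_bdry hq]

theorem greenOpZero_isHarm_F (hq : Equilateral q) (f : C(SG q, ℝ)) (i : Fin 3) :
    IsHarm q ((greenOpZero q f).comp (F q i)) := by
  have : (greenOpZero q f).comp (F q i) = ∑ k, (∑ l, (if k = l then 9 / 50 else 3 / 50)
      * ip q f (tentOne q l)) • (tentOne q k).comp (F q i) := by
    ext x
    simp only [greenOpZero, ContinuousMap.comp_apply, ContinuousMap.sum_apply,
      ContinuousMap.smul_apply]
  rw [this, ContinuousMap.coe_sum]
  exact IsHarm.sum _ fun k _ => (tentOne_isHarm_F hq k i).smul _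

/-- A discrete Gauss–Green identity: it closes the induction in `graphLaplacian_greenOp_bdry`,
turning the flux into the cell `F_j` into `3/5` of the moment of `f` itself. -/
theorem flux_bdry (hq : Equilateral q) (f : C(SG q, ℝ)) (j : Fin 3) :
    ∑ k, greenOpZero q f (F q j (bdry q k)) - 3 * greenOpZero q f (F q j (bdry q j))
      + 1 / 5 * moment hq (f.comp (F q j)) j = 3 / 5 * moment hq f j := by
  simp only [greenOpZero_F_bdry hq, ip_tentOne hq, moment_eq hq f j, Fin.sum_univ_three, rule,
    Pi.single_apply]
  fin_cases j <;> simp <;> ring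

/-- At a junction the fluxes of the level-zero part balance the moments of the two cells. This
cancels all terms of order `(3/5)^m` and leaves those of order `(1/5)^m`. -/
theorem flux_junction (hq : Equilateral q) (f : C(SG q, ℝ)) {i j : Fin 3} (hij : i ≠ j) :
    (∑ k, greenOpZero q f (F q i (bdry q k)) - 3 * greenOpZero q f (F q i (bdry q j)))
      + (∑ k, greenOpZero q f (F q j (bdry q k)) - 3 * greenOpZero q f (F q j (bdry q i)))
      = - (1 / 5) * (moment hq (f.comp (F q i)) j + moment hq (f.comp (F q j)) i) := by
  simp only [greenOpZero_F_bdry hq, ip_tentOne hq, Fin.sum_univ_three]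
  fin_cases i <;> fin_cases j <;> simp at hij ⊢ <;> ring

/-! ### The Laplacian of the Green operator -/

theorem graphLaplacian_greenOp_comp_F_bdry (hq : Equilateral q) (f : C(SG q, ℝ)) (m : ℕ)
    (i j : Fin 3) : graphLaplacian q m (greenOp hq f ∘ F q i) (bdry q j)
      = (3 / 5) ^ m * (∑ k, greenOpZero q f (F q i (bdry q k))
          - 3 * greenOpZero q f (F q i (bdry q j)))
        + 1 / 5 * graphLaplacian q m (greenOp hq (f.comp (F q i))) (bdry q j) := by
  rw [← ContinuousMap.coe_comp, greenOp_comp_F, ContinuousMap.coe_add, graphLaplacian_add,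
    (greenOpZero_isHarm_F hq f i).graphLaplacian_bdry hq, ContinuousMap.coe_smul,
    graphLaplacian_smul]
  rfl

theorem graphLaplacian_greenOp_bdry (hq : Equilateral q) (f : C(SG q, ℝ)) (m : ℕ) (j : Fin 3) :
    graphLaplacian q m (greenOp hq f) (bdry q j) = (3 / 5) ^ m * moment hq f j
      - (1 / 5) ^ m * moment hq (f.comp (wordMap q (List.replicate m j))) j := by
  induction m generalizing f with
  | zero =>
    rw [graphLaplacian_zero_bdry hq]
    simp only [greenOp_bdry]
    have : f.comp (wordMap q (List.replicate 0 j)) = f := rfl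
    rw [this]
    simp
  | succ m ih =>
    rw [graphLaplacian_succ_bdry hq, graphLaplacian_greenOp_comp_F_bdry, ih]
    have e : f.comp (wordMap q (List.replicate (m + 1) j))
      = (f.comp (F q j)).comp (wordMap q (List.replicate m j)) := rfl
    rw [e, pow_succ, mul_assoc _ (3 / 5 : ℝ), ← flux_bdry hq f j]
    ring

theorem wordMap_replicate_bdry (m : ℕ) (j : Fin 3) :
    wordMap q (List.replicate m j) (bdry q j) = bdry q j := by
  induction m with
  | zero => rfl
  | succ m ih => rw [List.replicate_succ, wordMap_cons, ih, F_bdry_self]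

/-- The formula is exact at every level: `w` and `w'` are the two cells of level `m` meeting at `x`,
and the right-hand side is `-(3/5)^m` times the integral of `f` against the tent at `x`. Inside a
cell the level-zero part is harmonic and drops out; at junctions the flux identities apply. -/
theorem exists_graphLaplacian_greenOp (hq : Equilateral q) (f : C(SG q, ℝ)) {m : ℕ} {x : SG q}
    (hx : x ∈ V q m) (hx0 : x ∉ V q 0) : ∃ (w w' : List (Fin 3)) (j j' : Fin 3),
      w.length = m ∧ w'.length = m ∧ wordMap q w (bdry q j) = x ∧ wordMap q w' (bdry q j') = x ∧
      graphLaplacian q m (greenOp hq f) x = - (1 / 5) ^ m *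
        (moment hq (f.comp (wordMap q w)) j + moment hq (f.comp (wordMap q w')) j') := by
  induction m generalizing f x with
  | zero => exact absurd hx hx0
  | succ m ih =>
    obtain ⟨i, y, hy, hy0, rfl⟩ | ⟨i, j, hij, rfl⟩ := V_succ_cases hx hx0
    · obtain ⟨w, w', j, j', hw, hw', hj, hj', h⟩ := ih (f.comp (F q i)) hy hy0
      refine ⟨i :: w, i :: w', j, j', by simp [hw], by simp [hw'], by simp [hj], by simp [hj'], ?_⟩
      have hz : graphLaplacian q m ((greenOpZero q f).comp (F q i)) y = 0 :=
        (greenOpZero_isHarm_F hq f i).graphLaplacian_eq_zero hq hy hy0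
      rw [graphLaplacian_succ_interior hq _ _ _ hy0, ← ContinuousMap.coe_comp, greenOp_comp_F,
        ContinuousMap.coe_add, graphLaplacian_add, hz, ContinuousMap.coe_smul,
        graphLaplacian_smul, h]
      change _ = -(1 / 5) ^ (m + 1) * (moment hq ((f.comp (F q i)).comp (wordMap q w)) j
        + moment hq ((f.comp (F q i)).comp (wordMap q w')) j')
      ring
    · refine ⟨i :: List.replicate m j, j :: List.replicate m i, j, i, by simp, by simp, ?_, ?_, ?_⟩
      · rw [wordMap_cons, wordMap_replicate_bdry]
      · rw [wordMap_cons, wordMap_replicate_bdry, F_bdry_comm]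
      · rw [graphLaplacian_succ_junction hq _ _ hij, graphLaplacian_greenOp_comp_F_bdry,
          graphLaplacian_greenOp_comp_F_bdry, graphLaplacian_greenOp_bdry,
          graphLaplacian_greenOp_bdry]
        change _ = -(1 / 5) ^ (m + 1) *
          (moment hq ((f.comp (F q i)).comp (wordMap q (List.replicate m j))) j
          + moment hq ((f.comp (F q j)).comp (wordMap q (List.replicate m i))) i)
        have h := congrArg (fun t => (3 / 5 : ℝ) ^ m * t) (flux_junction hq f hij)
        linear_combination h

/-- The Green operator inverts the Laplacian with Dirichlet boundary conditions. -/
theorem hasLaplacian_greenOp (hq : Equilateral q) (f : C(SG q, ℝ)) :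
    HasLaplacian q (greenOp hq f) (-f) := by
  intro ε hε
  obtain ⟨N, hN⟩ := exists_cell_osc_lt f (half_pos hε)
  refine ⟨N, fun m hm x hx hx0 => ?_⟩
  obtain ⟨w, w', j, j', hw, hw', hj, hj', h⟩ := exists_graphLaplacian_greenOp hq f hx hx0
  -- Each of the two moments is within `ε / 6` of `f x / 3`, so the prefactor `3/2` yields `f x` up
  -- to `ε / 2`.
  have h1 := abs_moment_sub_le hq (f.comp (wordMap q w)) j (c := f x) (ε := ε / 2) fun y => by
    conv_lhs => rw [← hj]
    exact (hN w (by omega) y (bdry q j)).le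
  have h2 := abs_moment_sub_le hq (f.comp (wordMap q w')) j' (c := f x) (ε := ε / 2) fun y => by
    conv_lhs => rw [← hj']
    exact (hN w' (by omega) y (bdry q j')).le
  have e : 3 / 2 * 5 ^ m * graphLaplacian q m (greenOp hq f) x = - (3 / 2) *
      (moment hq (f.comp (wordMap q w)) j + moment hq (f.comp (wordMap q w')) j') := by
    have e5 : (5 : ℝ) ^ m * (1 / 5) ^ m = 1 := by rw [← mul_pow]; norm_num
    rw [h]
    linear_combination (- (3 / 2) *
      (moment hq (f.comp (wordMap q w)) j + moment hq (f.comp (wordMap q w')) j')) * e5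
  rw [e, ContinuousMap.neg_apply, abs_lt]
  rw [abs_le] at h1 h2
  constructor <;> linarith [h1.1, h1.2, h2.1, h2.2]

end GreenOperator

section Monomials

variable {q : Fin 3 → Plane}

/-! ### Derivatives at the boundary point `q 0` -/

theorem hasNormalDeriv_zero_iff {u : SG q → ℝ} {d : ℝ} : HasNormalDeriv q u 0 d ↔
    Tendsto (fun m : ℕ => (5 / 3 : ℝ) ^ m * (2 * u (bdry q 0) - u ((F q 0)^[m] (bdry q 1))
      - u ((F q 0)^[m] (bdry q 2)))) atTop (𝓝 d) := Iff.rfl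

theorem hasTangentialDeriv_zero_iff {u : SG q → ℝ} {d : ℝ} : HasTangentialDeriv q u 0 d ↔
    Tendsto (fun m : ℕ => (5 : ℝ) ^ m * (u ((F q 0)^[m] (bdry q 1))
      - u ((F q 0)^[m] (bdry q 2)))) atTop (𝓝 d) := Iff.rfl

theorem HasNormalDeriv.sub {u v : C(SG q, ℝ)} {d e : ℝ} (hu : HasNormalDeriv q u 0 d)
    (hv : HasNormalDeriv q v 0 e) : HasNormalDeriv q (u - v : C(SG q, ℝ)) 0 (d - e) := by
  rw [hasNormalDeriv_zero_iff] at *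
  refine (Tendsto.sub hu hv).congr fun m => ?_
  simp only [ContinuousMap.sub_apply]
  ring

theorem HasTangentialDeriv.sub {u v : C(SG q, ℝ)} {d e : ℝ} (hu : HasTangentialDeriv q u 0 d)
    (hv : HasTangentialDeriv q v 0 e) :
    HasTangentialDeriv q (u - v : C(SG q, ℝ)) 0 (d - e) := by
  rw [hasTangentialDeriv_zero_iff] at *
  refine (Tendsto.sub hu hv).congr fun m => ?_
  simp only [ContinuousMap.sub_apply]
  ring

/-- A harmonic function is determined by its value and its derivatives at `q 0`. -/
theorem IsHarm.eq_zero_of_derivs {u : C(SG q, ℝ)} (hu : IsHarm q u) (h0 : u (bdry q 0) = 0)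
    (hn : HasNormalDeriv q u 0 0) (ht : HasTangentialDeriv q u 0 0) : u = 0 := by
  -- Along the cells shrinking to `q 0` the symmetric part decays like `(3/5)^m` and the
  -- antisymmetric part like `(1/5)^m`, the rates that the two derivatives compensate. Both limits
  -- are therefore limits of constant sequences.
  have key : ∀ m : ℕ,
      u ((F q 0)^[m] (bdry q 1)) + u ((F q 0)^[m] (bdry q 2))
        = (3 / 5) ^ m * (u (bdry q 1) + u (bdry q 2)) ∧
      u ((F q 0)^[m] (bdry q 1)) - u ((F q 0)^[m] (bdry q 2))
        = (1 / 5) ^ m * (u (bdry q 1) - u (bdry q 2)) := by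
    clear hn ht
    intro m
    induction m generalizing u with
    | zero => simp
    | succ m ih =>
      have h1 : u (F q 0 (bdry q 0)) = 0 := by rw [F_bdry_self]; exact h0
      obtain ⟨e1, e2⟩ := ih (u := u.comp (F q 0)) (hu.comp_F 0) h1
      have r1 := hu.F_bdry 0 1
      have r2 := hu.F_bdry 0 2
      simp only [ContinuousMap.comp_apply, ← Function.iterate_succ_apply' (F q 0)] at e1 e2
      rw [e1, e2, r1, r2]
      simp only [rule, Fin.sum_univ_three, h0]
      constructor
      · simp; ring
      · simp; ring
  rw [hasNormalDeriv_zero_iff] at hn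
  rw [hasTangentialDeriv_zero_iff] at ht
  have hn' : Tendsto (fun _ : ℕ => -(u (bdry q 1) + u (bdry q 2))) atTop (𝓝 0) := by
    refine hn.congr fun m => ?_
    have e : (5 / 3 : ℝ) ^ m * (3 / 5) ^ m = 1 := by rw [← mul_pow]; norm_num
    rw [h0]
    linear_combination -(5 / 3 : ℝ) ^ m * (key m).1 - (u (bdry q 1) + u (bdry q 2)) * e
  have ht' : Tendsto (fun _ : ℕ => u (bdry q 1) - u (bdry q 2)) atTop (𝓝 0) := by
    refine ht.congr fun m => ?_
    have e : (5 : ℝ) ^ m * (1 / 5) ^ m = 1 := by rw [← mul_pow]; norm_num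
    rw [(key m).2, ← mul_assoc, e, one_mul]
  have s1 := tendsto_nhds_unique hn' tendsto_const_nhds
  have s2 := tendsto_nhds_unique ht' tendsto_const_nhds
  refine hu.ext (v := 0) IsHarm.zero fun k => ?_
  rw [ContinuousMap.zero_apply]
  fin_cases k
  · exact h0
  · change u (bdry q 1) = 0; linarith
  · change u (bdry q 2) = 0; linarith

/-! ### Uniqueness and existence of the monomials -/

/-- Downward induction on the power of the Laplacian: once `Δ^{m+1}` agrees, the difference of the
`Δ^m` is harmonic with zero data at `q 0`. -/
theorem IsMonomial.unique (hq : Equilateral q) {j i : ℕ} {u v : C(SG q, ℝ)}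
    (hu : IsMonomial q 0 j i u) (hv : IsMonomial q 0 j i v) : u = v := by
  obtain ⟨D, hD0, hDL, hDj, hD⟩ := hu
  obtain ⟨E, hE0, hEL, hEj, hE⟩ := hv
  have key : ∀ k m, m + k = j + 1 → D m = E m := by
    intro k
    induction k with
    | zero =>
      intro m hm
      obtain rfl : m = j + 1 := hm
      rw [hDj, hEj]
    | succ k ih =>
      intro m hm
      have hmj : m ≤ j := by omega
      have hL := (hDL m hmj).sub (hEL m hmj)
      rw [ih (m + 1) (by omega), sub_self] at hL
      obtain ⟨d1, d2, d3⟩ := hD m hmj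
      obtain ⟨e1, e2, e3⟩ := hE m hmj
      have h2 := d2.sub e2
      have h3 := d3.sub e3
      rw [sub_self] at h2 h3
      refine sub_eq_zero.1 ((hL.isHarm hq).eq_zero_of_derivs ?_ h2 h3)
      rw [ContinuousMap.sub_apply, d1, e1, sub_self]
  rw [← hD0, ← hE0]
  exact key (j + 1) 0 (by omega)

/-- With `L = 5^{j+2}`, the potential `v` with `Δ v = f` satisfies the scaling up to the harmonic
error `L v ∘ F_0 - v`, because both terms have Laplacian `f`. A harmonic function added to `v`
removes the error without changing the Laplacian. -/
theorem exists_hasLaplacian_scaling (hq : Equilateral q) (j : ℕ) {f : C(SG q, ℝ)}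
    (hf : f.comp (F q 0) = (1 / 5 : ℝ) ^ (j + 1) • f) :
    ∃ u : C(SG q, ℝ), HasLaplacian q u f ∧ u.comp (F q 0) = (1 / 5 : ℝ) ^ (j + 2) • u := by
  set L : ℝ := 5 ^ (j + 2) with hL
  have hL5 : 25 ≤ L := by
    rw [hL, pow_add]
    have : (1 : ℝ) ≤ 5 ^ j := one_le_pow₀ (by norm_num)
    linarith
  have hLinv : L * (1 / 5) ^ (j + 2) = 1 := by rw [hL, ← mul_pow]; norm_num
  set v := (-1 : ℝ) • greenOp hq f with hv
  have hvL : HasLaplacian q v f := by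
    have h1 := (hasLaplacian_greenOp hq f).smul (-1)
    rwa [smul_neg, neg_one_smul ℝ f, neg_neg] at h1
  have hv0 : v (bdry q 0) = 0 := by simp [hv, greenOp_bdry]
  set h := L • v.comp (F q 0) - v with hh
  have hH : IsHarm q h := by
    refine HasLaplacian.isHarm hq ?_
    have h1 := ((hvL.comp_F hq 0).smul L).sub hvL
    rw [hf, smul_smul, smul_smul] at h1
    have e : L * (1 / 5) * (1 / 5) ^ (j + 1) = 1 := by
      rw [mul_assoc, ← pow_succ']
      exact hLinv
    rwa [e, one_smul, sub_self] at h1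
  have hh0 : h (bdry q 0) = 0 := by
    simp [hh, hv0, F_bdry_self]
  -- On harmonic functions vanishing at `q 0`, the map `g ↦ L g ∘ F_0 - g` acts on symmetric and
  -- antisymmetric boundary values as `3L/5 - 1` and `L/5 - 1`, both nonzero since `L ≥ 25`. Here
  -- `s` and `t` are the sum and difference of the values needed at `q 1` and `q 2`.
  set s := -(h (bdry q 1) + h (bdry q 2)) / (3 * L / 5 - 1) with hs
  set t := -(h (bdry q 1) - h (bdry q 2)) / (L / 5 - 1) with ht
  have hs' : s * (3 * L / 5 - 1) = -(h (bdry q 1) + h (bdry q 2)) :=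
    div_mul_cancel₀ _ (by linarith)
  have ht' : t * (L / 5 - 1) = -(h (bdry q 1) - h (bdry q 2)) :=
    div_mul_cancel₀ _ (by linarith)
  set a : Fin 3 → ℝ := ![0, (s + t) / 2, (s - t) / 2] with ha
  have hharm := isHarm_harm hq a
  have hz : h + (L • (harm hq a).comp (F q 0) - harm hq a) = 0 := by
    refine IsHarm.ext (v := 0) (hH.add (((hharm.comp_F 0).smul L).sub hharm)) IsHarm.zero
      fun k => ?_
    simp only [ContinuousMap.add_apply, ContinuousMap.sub_apply, ContinuousMap.smul_apply,
      ContinuousMap.comp_apply, hharm.F_bdry, harm_bdry, ContinuousMap.zero_apply, smul_eq_mul,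
      rule, Fin.sum_univ_three]
    fin_cases k
    · simp [ha, hh0]
    · simp [ha]; linarith
    · simp [ha]; linarith
  refine ⟨v + harm hq a, by simpa using hvL.add (hharm.hasLaplacian_zero hq), ?_⟩
  have e : L • (v + harm hq a).comp (F q 0) = v + harm hq a := by
    rw [← sub_eq_zero, ← hz, hh]
    ext x
    simp only [ContinuousMap.add_apply, ContinuousMap.sub_apply, ContinuousMap.smul_apply,
      ContinuousMap.comp_apply, smul_eq_mul]
    ring
  conv_rhs => rw [← e]
  rw [smul_smul, mul_comm, hLinv, one_smul]

theorem exists_scaling_sequence (hq : Equilateral q) : ∃ Q : ℕ → C(SG q, ℝ),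
    Q 0 = harm hq ![0, 1 / 2, -(1 / 2)] ∧ (∀ j, HasLaplacian q (Q (j + 1)) (Q j)) ∧
    ∀ j, (Q j).comp (F q 0) = (1 / 5 : ℝ) ^ (j + 1) • Q j := by
  choose step h1 h2 using fun (j : ℕ)
    (f : {f : C(SG q, ℝ) // f.comp (F q 0) = (1 / 5 : ℝ) ^ (j + 1) • f}) =>
      exists_hasLaplacian_scaling hq j f.2
  have h0 : (harm hq ![0, 1 / 2, -(1 / 2)]).comp (F q 0)
      = (1 / 5 : ℝ) ^ (0 + 1) • harm hq ![0, 1 / 2, -(1 / 2)] := by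
    rw [harm_comp_F, ← harm_smul]
    congr 1
    funext k
    simp only [rule, Fin.sum_univ_three, Pi.smul_apply, smul_eq_mul]
    fin_cases k <;> simp <;> ring
  let Q : (j : ℕ) → {f : C(SG q, ℝ) // f.comp (F q 0) = (1 / 5 : ℝ) ^ (j + 1) • f} :=
    fun j => Nat.rec ⟨_, h0⟩ (fun j f => ⟨step j f, h2 j f⟩) j
  exact ⟨fun j => (Q j).1, rfl, fun j => h1 j (Q j), fun j => (Q j).2⟩

theorem apply_iterate_of_scaling {u : C(SG q, ℝ)} {c : ℝ} (h : u.comp (F q 0) = c • u) (m : ℕ)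
    (x : SG q) : u ((F q 0)^[m] x) = c ^ m * u x := by
  induction m with
  | zero => simp
  | succ m ih =>
    have := DFunLike.congr_fun h ((F q 0)^[m] x)
    rw [ContinuousMap.comp_apply, ContinuousMap.smul_apply, ih, smul_eq_mul] at this
    rw [Function.iterate_succ_apply', this, pow_succ]
    ring

theorem apply_bdry_of_scaling {u : C(SG q, ℝ)} (j : ℕ)
    (h : u.comp (F q 0) = (1 / 5 : ℝ) ^ (j + 1) • u) : u (bdry q 0) = 0 := by
  have h1 := DFunLike.congr_fun h (bdry q 0)
  rw [ContinuousMap.comp_apply, F_bdry_self, ContinuousMap.smul_apply, smul_eq_mul] at h1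
  have h2 : (1 / 5 : ℝ) ^ (j + 1) < 1 := pow_lt_one₀ (by norm_num) (by norm_num) (by omega)
  have h3 : (1 - (1 / 5 : ℝ) ^ (j + 1)) * u (bdry q 0) = 0 := by linarith
  exact (mul_eq_zero.1 h3).resolve_left (by linarith)

theorem tendsto_pow_mul_pow_mul {a b : ℝ} (h : |a * b| < 1) (c : ℝ) :
    Tendsto (fun m : ℕ => a ^ m * (b ^ m * c)) atTop (𝓝 0) := by
  have := (tendsto_pow_atTop_nhds_zero_of_abs_lt_one h).mul_const c
  rw [zero_mul] at this
  refine this.congr fun m => ?_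
  rw [mul_pow]; ring

/-- By scaling, the sequences defining the normal and tangential derivatives of `Q k` are geometric
with ratios `(5/3) 5^{-(k+1)}` and `5^{-k}`. Only the tangential one for `k = 0` survives, and the
base function has `Q 0 (q 1) - Q 0 (q 2) = 1`. -/
theorem isMonomial_of_scaling_sequence (hq : Equilateral q) {Q : ℕ → C(SG q, ℝ)}
    (h0 : Q 0 = harm hq ![0, 1 / 2, -(1 / 2)]) (hL : ∀ j, HasLaplacian q (Q (j + 1)) (Q j))
    (hs : ∀ j, (Q j).comp (F q 0) = (1 / 5 : ℝ) ^ (j + 1) • Q j) (j : ℕ) :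
    IsMonomial q 0 j 3 (Q j) := by
  have hN : ∀ k, HasNormalDeriv q (Q k) 0 0 := by
    intro k
    rw [hasNormalDeriv_zero_iff]
    have hb : |(5 / 3 : ℝ) * (1 / 5) ^ (k + 1)| < 1 := by
      have h1 : (1 / 5 : ℝ) ^ k ≤ 1 := pow_le_one₀ (by norm_num) (by norm_num)
      rw [abs_of_pos (by positivity), pow_succ]
      linarith
    refine (tendsto_pow_mul_pow_mul hb (-(Q k (bdry q 1) + Q k (bdry q 2)))).congr fun m => ?_
    rw [apply_bdry_of_scaling k (hs k), apply_iterate_of_scaling (hs k),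
      apply_iterate_of_scaling (hs k)]
    ring
  have hT : ∀ k, HasTangentialDeriv q (Q k) 0 (if k = 0 then 1 else 0) := by
    intro k
    rw [hasTangentialDeriv_zero_iff]
    have e : ∀ m, ((1 / 5 : ℝ) ^ (k + 1)) ^ m * (Q k (bdry q 1) - Q k (bdry q 2))
        = Q k ((F q 0)^[m] (bdry q 1)) - Q k ((F q 0)^[m] (bdry q 2)) := by
      intro m
      rw [apply_iterate_of_scaling (hs k), apply_iterate_of_scaling (hs k)]
      ring
    split_ifs with hk
    · subst hk
      refine tendsto_const_nhds.congr fun m => ?_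
      have e2 : (![0, 1 / 2, -(1 / 2)] : Fin 3 → ℝ) 2 = -(1 / 2) := rfl
      rw [← e, ← mul_assoc, ← mul_pow, h0, harm_bdry, harm_bdry, e2]
      norm_num
    · have hb : |(5 : ℝ) * (1 / 5) ^ (k + 1)| < 1 := by
        have h1 : (1 / 5 : ℝ) ^ k < 1 := pow_lt_one₀ (by norm_num) (by norm_num) hk
        rw [abs_of_pos (by positivity), pow_succ]
        linarith
      refine (tendsto_pow_mul_pow_mul hb (Q k (bdry q 1) - Q k (bdry q 2))).congr fun m => ?_
      rw [e]
  refine ⟨fun m => if m ≤ j then Q (j - m) else 0, by simp, fun m hm => ?_, by simp,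
    fun m hm => ?_⟩
  · simp only [if_pos hm]
    by_cases hmj : m + 1 ≤ j
    · rw [if_pos hmj]
      have : j - m = (j - (m + 1)) + 1 := by omega
      rw [this]
      exact hL _
    · rw [if_neg hmj]
      have : j - m = 0 := by omega
      rw [this, h0]
      exact (isHarm_harm hq _).hasLaplacian_zero hq
  · simp only [if_pos hm]
    refine ⟨?_, ?_, ?_⟩
    · rw [apply_bdry_of_scaling _ (hs (j - m))]; simp
    · simpa using hN (j - m)
    · convert hT (j - m) using 2
      simp only [and_true]
      exact ⟨fun h => by omega, fun h => by omega⟩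

/-! ### Properties of the antisymmetric monomials -/

theorem isMonomial_P (hq : Equilateral q) (j : ℕ) : IsMonomial q 0 j 3 (P q j) := by
  obtain ⟨Q, h0, hL, hs⟩ := exists_scaling_sequence hq
  exact Classical.epsilon_spec ⟨Q j, isMonomial_of_scaling_sequence hq h0 hL hs j⟩

/-- Uniqueness identifies the chosen monomials with the constructed sequence, which transfers both
the Laplacian chain and the scaling. -/
theorem P_spec (hq : Equilateral q) : P q 0 = harm hq ![0, 1 / 2, -(1 / 2)] ∧
    (∀ j, HasLaplacian q (P q (j + 1)) (P q j)) ∧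
    ∀ j, (P q j).comp (F q 0) = (1 / 5 : ℝ) ^ (j + 1) • P q j := by
  obtain ⟨Q, h0, hL, hs⟩ := exists_scaling_sequence hq
  have : P q = Q := funext fun j =>
    (isMonomial_P hq j).unique hq (isMonomial_of_scaling_sequence hq h0 hL hs j)
  rw [this]
  exact ⟨h0, hL, hs⟩

theorem P_bdry_zero (hq : Equilateral q) (j : ℕ) : P q j (bdry q 0) = 0 :=
  apply_bdry_of_scaling j ((P_spec hq).2.2 j)

theorem gam_zero (hq : Equilateral q) : gam q 0 = 1 / 2 := by
  rw [gam, (P_spec hq).1, harm_bdry]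
  rfl

/-- The monomials `P_{j3}` are antisymmetric. -/
theorem P_bdry_two (hq : Equilateral q) (j : ℕ) : P q j (bdry q 2) = - gam q j := by
  obtain ⟨σ, hb, hF, hσ⟩ := exists_reflection hq
  have hb0 : σ (bdry q 0) = bdry q 0 := hb 0
  have hb1 : σ (bdry q 1) = bdry q 2 := hb 1
  have hb2 : σ (bdry q 2) = bdry q 1 := hb 2
  have hit : ∀ m x, σ ((F q 0)^[m] x) = (F q 0)^[m] (σ x) := by
    intro m x
    induction m with
    | zero => rfl
    | succ m ih =>
      rw [Function.iterate_succ_apply', Function.iterate_succ_apply', hF, ih]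
      rfl
  -- The negated reflection has the same defining data: it leaves the vanishing ones zero, and the
  -- reversal of the tangential derivative is undone by the sign. Uniqueness then gives
  -- antisymmetry.
  have hmon : IsMonomial q 0 j 3 ((-1 : ℝ) • (P q j).comp σ) := by
    obtain ⟨D, hD0, hDL, hDj, hD⟩ := isMonomial_P hq j
    refine ⟨fun m => (-1 : ℝ) • (D m).comp σ, by simp only [hD0],
      fun m hm => ((hDL m hm).comp_symm hb hF hσ).smul (-1), ?_, fun m hm => ?_⟩
    · ext x; simp [hDj]
    · obtain ⟨d1, d2, d3⟩ := hD m hm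
      refine ⟨?_, ?_, ?_⟩
      · rw [ContinuousMap.smul_apply, ContinuousMap.comp_apply, hb0, d1]
        simp
      · have d2' : HasNormalDeriv q (D m) 0 0 := by simpa using d2
        have : HasNormalDeriv q ((-1 : ℝ) • (D m).comp σ : C(SG q, ℝ)) 0 (-0) := by
          rw [hasNormalDeriv_zero_iff] at d2' ⊢
          refine d2'.neg.congr fun k => ?_
          simp only [ContinuousMap.smul_apply, ContinuousMap.comp_apply, hit, hb0, hb1, hb2,
            smul_eq_mul]
          ring
        simpa using this
      · rw [hasTangentialDeriv_zero_iff] at d3 ⊢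
        refine d3.congr fun k => ?_
        simp only [ContinuousMap.smul_apply, ContinuousMap.comp_apply, hit, hb1, hb2,
          smul_eq_mul]
        ring
  have h := DFunLike.congr_fun ((isMonomial_P hq j).unique hq hmon) (bdry q 2)
  rw [h, ContinuousMap.smul_apply, ContinuousMap.comp_apply, hb2, gam]
  simp

theorem P_ne_zero (hq : Equilateral q) (j : ℕ) : P q j ≠ 0 := by
  induction j with
  | zero =>
    intro h
    have := gam_zero hq
    rw [gam, h] at this
    norm_num at this
  | succ j ih =>
    intro h
    have := (P_spec hq).2.1 j
    rw [h] at this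
    exact ih (this.eq_zero hq)

/-- The monomials `P_{j3}` are linearly independent, being eigenvectors of composition with `F_0`
for different eigenvalues. -/
theorem linearIndependent_P (hq : Equilateral q) : LinearIndependent ℝ (P q) := by
  let T : Module.End ℝ C(SG q, ℝ) :=
    { toFun := fun u => u.comp (F q 0)
      map_add' := fun _ _ => rfl
      map_smul' := fun _ _ => rfl }
  refine Module.End.eigenvectors_linearIndependent' T (fun j : ℕ => (1 / 5 : ℝ) ^ (j + 1)) ?_ _
    fun j => ⟨Module.End.mem_eigenspace_iff.2 ((P_spec hq).2.2 j), P_ne_zero hq j⟩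
  intro i j h
  have := pow_right_injective₀ (by norm_num : (0 : ℝ) < 1 / 5) (by norm_num) h
  omega

end Monomials

section OrthogonalPolynomials

variable {q : Fin 3 → Plane}

/-! ### The spans of the monomials -/

/-- The span of `P_0, …, P_{n-1}`. -/
noncomputable def spanP (q : Fin 3 → Plane) (n : ℕ) : Submodule ℝ C(SG q, ℝ) :=
  Submodule.span ℝ (Set.range fun l : Fin n => P q l)

theorem P_mem_spanP {l n : ℕ} (h : l < n) : P q l ∈ spanP q n :=
  Submodule.subset_span ⟨⟨l, h⟩, rfl⟩

theorem spanP_mono {m n : ℕ} (h : m ≤ n) : spanP q m ≤ spanP q n := by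
  refine Submodule.span_le.2 ?_
  rintro _ ⟨l, rfl⟩
  exact P_mem_spanP (l.2.trans_le h)

theorem P_not_mem_spanP (hq : Equilateral q) (n : ℕ) : P q n ∉ spanP q n := by
  have h : (Set.range fun l : Fin n => P q l) = P q '' Set.Iio n := by
    ext u
    constructor
    · rintro ⟨l, rfl⟩; exact ⟨l, l.2, rfl⟩
    · rintro ⟨l, hl, rfl⟩; exact ⟨⟨l, hl⟩, rfl⟩
  rw [spanP, h]
  exact (linearIndependent_P hq).notMem_span_image (by simp)

theorem sum_smul_P_injective (hq : Equilateral q) {n : ℕ} {v w : Fin n → ℝ}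
    (h : ∑ l, v l • P q l = ∑ l, w l • P q l) : v = w := by
  have hli : LinearIndependent ℝ fun l : Fin n => P q l :=
    (linearIndependent_P hq).comp _ Fin.val_injective
  funext l
  refine sub_eq_zero.1 (Fintype.linearIndependent_iff.1 hli (v - w) ?_ l)
  simp only [Pi.sub_apply, sub_smul, Finset.sum_sub_distrib, h, sub_self]

/-! ### The Gram–Schmidt process -/

theorem p_eq (k : ℕ) : p q k
    = P q k - ∑ l : Fin k, (ip q (P q k) (p q l) / ip q (p q l) (p q l)) • p q l := by
  rw [p]

theorem p_sub_P_mem (k : ℕ) : p q k - P q k ∈ spanP q k := by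
  induction k using Nat.strong_induction_on with
  | _ k ih =>
    rw [p_eq, sub_sub_cancel_left]
    refine neg_mem (Submodule.sum_mem _ fun l _ => Submodule.smul_mem _ _ ?_)
    have := add_mem (spanP_mono l.2.le (ih l l.2)) (P_mem_spanP (q := q) l.2)
    rwa [sub_add_cancel] at this

theorem p_mem_spanP {k n : ℕ} (h : k < n) : p q k ∈ spanP q n := by
  have := add_mem (spanP_mono h.le (p_sub_P_mem (q := q) k)) (P_mem_spanP (q := q) h)
  rwa [sub_add_cancel] at this

/-- If `p_k` were zero, `P_k` would lie in the span of its predecessors. So the divisions in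
Gram–Schmidt, `b` and `c` are genuine. -/
theorem ip_p_self_ne_zero (hq : Equilateral q) (k : ℕ) : ip q (p q k) (p q k) ≠ 0 := by
  intro h
  have h1 := p_sub_P_mem (q := q) k
  rw [eq_zero_of_ip_self h, zero_sub, neg_mem_iff] at h1
  exact P_not_mem_spanP hq k h1

theorem ip_p_of_lt (hq : Equilateral q) {j l : ℕ} (hl : l < j) : ip q (p q j) (p q l) = 0 := by
  induction j using Nat.strong_induction_on generalizing l with
  | _ j ih =>
    rw [p_eq j, ip_sub_left, ip_sum_left, Finset.sum_eq_single ⟨l, hl⟩]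
    · rw [ip_smul_left, div_mul_cancel₀ _ (ip_p_self_ne_zero hq l), sub_self]
    · intro i _ hi
      rw [ip_smul_left]
      rcases lt_trichotomy (i : ℕ) l with h | h | h
      · rw [ip_comm (p q i) (p q l), ih l hl h, mul_zero]
      · exact absurd (Fin.ext h) hi
      · rw [ih i i.2 h, mul_zero]
    · simp

/-- Orthogonality to `p_0, …, p_{n-1}` means orthogonality to `P_0, …, P_{n-1}`. -/
theorem ip_eq_zero_of_mem_spanP {n : ℕ} {d : C(SG q, ℝ)} (h : ∀ l < n, ip q d (p q l) = 0)
    {u : C(SG q, ℝ)} (hu : u ∈ spanP q n) : ip q d u = 0 := by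
  have hP : ∀ l < n, ip q d (P q l) = 0 := by
    intro l hl
    have e : P q l = p q l
        + ∑ i : Fin l, (ip q (P q l) (p q i) / ip q (p q i) (p q i)) • p q i := by
      conv_rhs => rw [p_eq l]
      rw [sub_add_cancel]
    rw [ip_comm, e, ip_add_left, ip_comm, h l hl, zero_add, ip_sum_left]
    refine Finset.sum_eq_zero fun i _ => ?_
    rw [ip_smul_left, ip_comm (p q i) d, h i (i.2.trans hl), mul_zero]
  rw [ip_comm]
  induction hu using Submodule.span_induction with
  | mem u hu =>
    obtain ⟨l, rfl⟩ := hu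
    rw [ip_comm]
    exact hP l l.2
  | zero => simp [ip]
  | add u v _ _ hu hv => rw [ip_add_left, hu, hv, add_zero]
  | smul a u _ hu => rw [ip_smul_left, hu, mul_zero]

theorem ip_p_of_mem_spanP (hq : Equilateral q) {k : ℕ} {u : C(SG q, ℝ)} (hu : u ∈ spanP q k) :
    ip q (p q k) u = 0 :=
  ip_eq_zero_of_mem_spanP (fun _ hl => ip_p_of_lt hq hl) hu

/-- The coefficient vectors of the orthogonal polynomials. -/
theorem exists_coefficients (k : ℕ) : ∃ v : Fin (k + 1) → ℝ,
    p q k = ∑ l, v l • P q l ∧ v (Fin.last k) = 1 := by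
  obtain ⟨c, hc⟩ := (Submodule.mem_span_range_iff_exists_fun ℝ).1 (p_sub_P_mem (q := q) k)
  refine ⟨Fin.snoc c 1, ?_, Fin.snoc_last _ _⟩
  rw [Fin.sum_univ_castSucc]
  simp only [Fin.snoc_castSucc, Fin.snoc_last, Fin.val_castSucc, Fin.val_last, one_smul]
  rw [hc, sub_add_cancel]

/-! ### The three-term recursion -/

/-- `f_{k+1}` as a continuous function. -/
noncomputable def fNextC (hq : Equilateral q) (k : ℕ) : C(SG q, ℝ) := (-1 : ℝ) • greenOp hq (p q k)

theorem coe_fNextC (hq : Equilateral q) (k : ℕ) : ⇑(fNextC hq k) = fNext q k := by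
  funext x
  rw [fNextC, ContinuousMap.smul_apply, greenOp_apply, fNext, smul_eq_mul, neg_one_mul]

theorem ip_fNextC (hq : Equilateral q) (k l : ℕ) :
    ip q (fNextC hq k) (p q l) = ip q (p q k) (fNextC hq l) := by
  rw [fNextC, ip_smul_left, ip_greenOp, ip_comm (p q k) (fNextC hq l), fNextC, ip_smul_left,
    ip_comm (greenOp hq (p q l))]

theorem fNextC_bdry (hq : Equilateral q) (k : ℕ) (i : Fin 3) : fNextC hq k (bdry q i) = 0 := by
  rw [fNextC, ContinuousMap.smul_apply, greenOp_bdry, smul_zero]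

theorem hasLaplacian_fNextC (hq : Equilateral q) (k : ℕ) :
    HasLaplacian q (fNextC hq k) (p q k) := by
  have h := (hasLaplacian_greenOp hq (p q k)).smul (-1)
  rwa [smul_neg, neg_one_smul ℝ (p q k), neg_neg] at h

/-- Both `f_{k+1}` and the shifted sum have Laplacian `p_k`, so their difference is harmonic. By
antisymmetry its boundary values are those of a multiple of `P_0`, and the vanishing of `f_{k+1}` at
`q 1` forces the factor `zeta`. -/
theorem fNextC_eq (hq : Equilateral q) {k : ℕ} {v : Fin (k + 1) → ℝ}
    (hv : p q k = ∑ l, v l • P q l) :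
    fNextC hq k = zeta q v • P q 0 + ∑ l, v l • P q (l + 1) := by
  set S : C(SG q, ℝ) := ∑ l, v l • P q (l + 1) with hS
  have hSL : HasLaplacian q S (p q k) := by
    rw [hv]
    exact HasLaplacian.sum _ fun l _ => ((P_spec hq).2.1 l).smul (v l)
  have hD : IsHarm q (fNextC hq k - S : C(SG q, ℝ)) := by
    refine HasLaplacian.isHarm hq ?_
    have := (hasLaplacian_fNextC hq k).sub hSL
    rwa [sub_self] at this
  have hP0 : IsHarm q (P q 0) := by
    rw [(P_spec hq).1]; exact isHarm_harm hq _
  have key : fNextC hq k - S = zeta q v • P q 0 := by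
    refine hD.ext (hP0.smul (zeta q v)) fun i => ?_
    have hz : zeta q v * gam q 0 = -∑ l, v l * gam q (l + 1) := by
      rw [zeta, gam_zero hq]; ring
    rw [ContinuousMap.sub_apply, fNextC_bdry, ContinuousMap.smul_apply, hS,
      ContinuousMap.sum_apply, smul_eq_mul]
    simp only [ContinuousMap.smul_apply, smul_eq_mul]
    fin_cases i
    · simp [P_bdry_zero hq]
    · change 0 - ∑ l, v l * gam q (l + 1) = zeta q v * gam q 0
      rw [hz, zero_sub]
    · change 0 - ∑ l : Fin (k + 1), v l * P q (l + 1) (bdry q 2) = zeta q v * P q 0 (bdry q 2)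
      simp only [P_bdry_two hq, mul_neg, Finset.sum_neg_distrib]
      rw [hz]; ring
  rw [← key, sub_add_cancel]

theorem fNextC_sub_P_mem (hq : Equilateral q) (k : ℕ) :
    fNextC hq k - P q (k + 1) ∈ spanP q (k + 1) := by
  obtain ⟨v, hv, hv1⟩ := exists_coefficients (q := q) k
  rw [fNextC_eq hq hv, Fin.sum_univ_castSucc, hv1, one_smul, Fin.val_last, ← add_assoc,
    add_sub_cancel_right]
  refine add_mem (Submodule.smul_mem _ _ (P_mem_spanP (Nat.succ_pos k)))
    (Submodule.sum_mem _ fun l _ => Submodule.smul_mem _ _ (P_mem_spanP ?_))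
  simp

theorem fNextC_mem (hq : Equilateral q) {k n : ℕ} (h : k + 1 < n) : fNextC hq k ∈ spanP q n := by
  have := add_mem (spanP_mono h.le (fNextC_sub_P_mem hq k)) (P_mem_spanP (q := q) h)
  rwa [sub_add_cancel] at this

/-- The polynomial `p_{k-1}`, where `p_{-1} = 0`. -/
noncomputable def pPrev (q : Fin 3 → Plane) : ℕ → C(SG q, ℝ)
  | 0 => 0
  | k + 1 => p q k

theorem pPrev_mem (k : ℕ) : pPrev q k ∈ spanP q k := by
  cases k with
  | zero => exact zero_mem _
  | succ k => exact p_mem_spanP (Nat.lt_succ_self k)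

/-- Symmetry of the Green operator moves it onto `p_l`, and `f_{l+1}` has leading term `P_{l+1}`.
The product with `p_k` thus vanishes for `l + 1 < k` and equals `‖p_k‖²` for `l + 1 = k`. -/
theorem c_mul_ip_pPrev (hq : Equilateral q) {k l : ℕ} (h : l < k) :
    c q k * ip q (pPrev q k) (p q l) = ip q (fNextC hq k) (p q l) := by
  obtain _ | k := k
  · omega
  change ip q (p q (k + 1)) (p q (k + 1)) / ip q (p q k) (p q k) * ip q (p q k) (p q l) = _
  rw [ip_fNextC]
  obtain rfl | hlk := Nat.eq_or_lt_of_le (Nat.le_of_lt_succ h)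
  · have h1 := ip_p_of_mem_spanP hq (fNextC_sub_P_mem hq l)
    have h2 := ip_p_of_mem_spanP hq (p_sub_P_mem (q := q) (l + 1))
    rw [ip_comm, ip_sub_left, sub_eq_zero] at h1 h2
    rw [div_mul_cancel₀ _ (ip_p_self_ne_zero hq l), ip_comm (p q (l + 1)) (fNextC hq l), h1, h2]
  · rw [ip_p_of_lt hq hlk, mul_zero, ip_p_of_mem_spanP hq (fNextC_mem hq (by omega))]

/-- The leading terms cancel, so the difference of the two sides lies in the span of `P_0, …, P_k`;
it is orthogonal to this span, hence zero. -/
theorem three_term_recursion (hq : Equilateral q) (k : ℕ) :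
    p q (k + 1) = fNextC hq k - b q k • p q k - c q k • pPrev q k := by
  set R := fNextC hq k - b q k • p q k - c q k • pPrev q k with hR
  have hmem : p q (k + 1) - R ∈ spanP q (k + 1) := by
    have e : p q (k + 1) - R = (p q (k + 1) - P q (k + 1)) - (fNextC hq k - P q (k + 1))
        + b q k • p q k + c q k • pPrev q k := by rw [hR]; abel
    rw [e]
    exact add_mem (add_mem (sub_mem (p_sub_P_mem _) (fNextC_sub_P_mem hq k))
      (Submodule.smul_mem _ _ (p_mem_spanP (Nat.lt_succ_self k))))
      (Submodule.smul_mem _ _ (spanP_mono (Nat.le_succ k) (pPrev_mem k)))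
  have horth : ∀ l < k + 1, ip q (p q (k + 1) - R : C(SG q, ℝ)) (p q l) = 0 := by
    intro l hl
    rw [ip_sub_left, ip_p_of_lt hq hl, hR, ip_sub_left, ip_sub_left, ip_smul_left, ip_smul_left]
    obtain rfl | hlk := Nat.eq_or_lt_of_le (Nat.le_of_lt_succ hl)
    · rw [ip_comm (pPrev q l), ip_p_of_mem_spanP hq (pPrev_mem l), b,
        div_mul_cancel₀ _ (ip_p_self_ne_zero hq l), coe_fNextC]
      ring
    · rw [ip_p_of_lt hq hlk, c_mul_ip_pPrev hq hlk]
      ring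
  exact sub_eq_zero.1 (eq_zero_of_ip_self (ip_eq_zero_of_mem_spanP horth hmem))

/-! ### Coefficient vectors -/

theorem sum_push_smul_P {n : ℕ} (a : ℝ) (v : Fin n → ℝ) :
    ∑ l, push a v l • P q l = a • P q 0 + ∑ l, v l • P q (l + 1) := by
  rw [Fin.sum_univ_succ]
  simp [push]

theorem sum_padZero_smul_P {n : ℕ} (v : Fin n → ℝ) :
    ∑ l, padZero v l • P q l = ∑ l, v l • P q l := by
  rw [Fin.sum_univ_castSucc]
  simp [padZero]

theorem sum_prev_smul_P {Om : (k : ℕ) → Fin (k + 1) → ℝ}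
    (h : ∀ k, p q k = ∑ l, Om k l • P q l) (k : ℕ) :
    ∑ l, prev Om k l • P q l = pPrev q k := by
  cases k with
  | zero => rfl
  | succ k => exact (h k).symm

end OrthogonalPolynomials

end SGOP

/-- Recursion for the coefficient vectors `Ω_k` of the orthogonal polynomials `p_k` in the basis
of monomials `P_{03}, P_{13}, …` on the Sierpinski gasket. -/
theorem theorem3p6 (q : Fin 3 → EuclideanSpace ℝ (Fin 2)) (s : ℝ) (hs : 0 < s)
    (hq : ∀ i j, i ≠ j → dist (q i) (q j) = s) :
    ∃ Om : (k : ℕ) → Fin (k + 1) → ℝ,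
      (∀ (k : ℕ) (v : Fin (k + 1) → ℝ),
        SGOP.p q k = ∑ l, v l • SGOP.P q l ↔ v = Om k) ∧
      (∀ k : ℕ, Om k (Fin.last k) = 1) ∧
      ∀ k : ℕ,
        Om (k + 1) = SGOP.push (SGOP.zeta q (Om k)) (Om k)
          - SGOP.b q k • SGOP.padZero (Om k)
          - SGOP.c q k • SGOP.padZero (SGOP.padZero (SGOP.prev Om k)) := by
  have h : SGOP.Equilateral q := ⟨s, hs, hq⟩
  choose Om hOm hlast using SGOP.exists_coefficients (q := q)
  have hiff : ∀ (k : ℕ) (v : Fin (k + 1) → ℝ),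
      SGOP.p q k = ∑ l, v l • SGOP.P q l ↔ v = Om k := by
    refine fun k v => ⟨fun hv => ?_, fun hv => hv ▸ hOm k⟩
    exact SGOP.sum_smul_P_injective h (hv.symm.trans (hOm k))
  -- Coefficients being unique, it is enough that the vector on the right represents `p_{k+1}`,
  -- which is the recursion for functions.
  refine ⟨Om, hiff, hlast, fun k => ((hiff (k + 1) _).1 ?_).symm⟩
  simp only [Pi.sub_apply, Pi.smul_apply, smul_eq_mul, sub_smul, mul_smul,
    Finset.sum_sub_distrib, ← Finset.smul_sum]
  rw [SGOP.sum_push_smul_P, SGOP.sum_padZero_smul_P, SGOP.sum_padZero_smul_P,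
    SGOP.sum_padZero_smul_P, SGOP.sum_prev_smul_P hOm, ← hOm k, ← SGOP.fNextC_eq h (hOm k)]
  exact SGOP.three_term_recursion h k
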